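/- \textbf{Notation.} Let $p\ge 1$ be an integer, $\alpha,\beta\in\mathbb{R}$. For $n\ge 1$ let $N_1^p,\dots,N_{n+p}^p$ be the B-splines of degree $p$ on $[0,1]$ for the knots $\xi_1=\dots=\xi_{p+1}=0$, $\xi_{i+p+1}=i/n$ $(0\le i\le n)$, $\xi_{p+n+1}=\dots=\xi_{2p+n+1}=1$ (defined by the Cox--de Boor recursion), and define the $(n+p-2)\times(n+p-2)$ matrices $$M_n^p=\Big[\int_0^1 N_{i+1}^pN_{j+1}^p\Big]_{i,j},\quad A_n^p=\Big[\int_0^1 N_{i+1}^p(N_{j+1}^p)'\Big]_{i,j},\quad S_n^p=\Big[\int_0^1 (N_{i+1}^p)'(N_{j+1}^p)'\Big]_{i,j}.$$ For $\bm n=(n_1,n_2,n_3)$ write $M_l,A_l,S_l$ for $M^p_{n_l},A^p_{n_l},S^p_{n_l}$ and let $\mathcal{A}^{p,\alpha,\beta}_{\bm n}$ be the matrix of size $3\prod_{l=1}^3(n_l+p-2)$ $$\alpha\begin{bmatrix} M_1\otimes M_2\otimes S_3+M_1\otimes S_2\otimes M_3 & -A_1^T\otimes A_2\otimes M_3 &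 -A_1^T\otimes M_2\otimes A_3\\ -A_1\otimes A_2^T\otimes M_3 & S_1\otimes M_2\otimes M_3+M_1\otimes M_2\otimes S_3 & -M_1\otimes A_2^T\otimes A_3\\ -A_1\otimes M_2\otimes A_3^T & -M_1\otimes A_2\otimes A_3^T & S_1\otimes M_2\otimes M_3+M_1\otimes S_2\otimes M_3\end{bmatrix}$$ $$+\,\beta\begin{bmatrix} S_1\otimes M_2\otimes M_3 & A_1\otimes A_2^T\otimes M_3 & A_1\otimes M_2\otimes A_3^T\\ A_1^T\otimes A_2\otimes M_3 & M_1\otimes S_2\otimes M_3 & M_1\otimes A_2\otimes A_3^T\\ A_1^T\otimes M_2\otimes A_3 & M_1\otimes A_2^T\otimes A_3 & M_1\otimes M_2\otimes S_3\end{bmatrix},$$ which arises from the tensor-product B-spline discretization of $\alpha(\nabla\times\bm u,\nabla\times\bm v)+\beta(\nabla\cdot\bm u,\nabla\cdot\bm v)$ on $(0,1)^3$ with homogeneous Dirichlet conditions. Let $\phi_0$ be the indicator function of $[0,1)$ and $\phi_q(t)=\frac{t}{q}\phi_{q-1}(t)+\frac{q+1-t}{q}\phi_{q-1}(t-1)$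 for $q\ge1$, and put $$\mathfrak m_p(\theta)=\phi_{2p+1}(p+1)+2\sum_{k=1}^p\phi_{2p+1}(p+1-k)\cos(k\theta),\qquad \mathfrak a_p(\theta)=-2\sum_{k=1}^p\phi_{2p+1}'(p+1-k)\sin(k\theta),$$ $$\mathfrak s_p(\theta)=-\phi_{2p+1}''(p+1)-2\sum_{k=1}^p\phi_{2p+1}''(p+1-k)\cos(k\theta).$$ \textbf{Theorem.} Let $\nu_1,\nu_2,\nu_3$ be positive rational numbers, and let $\bm n=(n\nu_1,n\nu_2,n\nu_3)$, where $n$ runs through the positive integers for which $\bm n\in\mathbb{N}^3$. Put $\gamma_i=\nu_i^2/(\nu_1\nu_2\nu_3)$, $\delta_i=1/\nu_i$, and let $f=f^{p,\alpha,\beta}:[-\pi,\pi]^3\to\mathbb{C}^{3\times3}$ be the matrix-valued function with entries, at $(\theta_1,\theta_2,\theta_3)$ and with $\mathfrak m_i=\mathfrak m_p(\theta_i)$, $\mathfrak a_i=\mathfrak a_p(\theta_i)$, $\mathfrak s_i=\mathfrak s_p(\theta_i)$, \begin{align*} f_{1,1}&=\beta\gamma_1\mathfrak s_1\mathfrak m_2\mathfrak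 m_3+\alpha\gamma_2\mathfrak m_1\mathfrak s_2\mathfrak m_3+\alpha\gamma_3\mathfrak m_1\mathfrak m_2\mathfrak s_3,\\ f_{2,2}&=\alpha\gamma_1\mathfrak s_1\mathfrak m_2\mathfrak m_3+\beta\gamma_2\mathfrak m_1\mathfrak s_2\mathfrak m_3+\alpha\gamma_3\mathfrak m_1\mathfrak m_2\mathfrak s_3,\\ f_{3,3}&=\alpha\gamma_1\mathfrak s_1\mathfrak m_2\mathfrak m_3+\alpha\gamma_2\mathfrak m_1\mathfrak s_2\mathfrak m_3+\beta\gamma_3\mathfrak m_1\mathfrak m_2\mathfrak s_3,\\ f_{1,2}=f_{2,1}&=-(\alpha-\beta)\delta_3\mathfrak a_1\mathfrak a_2\mathfrak m_3,\quad f_{1,3}=f_{3,1}=-(\alpha-\beta)\delta_2\mathfrak a_1\mathfrak m_2\mathfrak a_3,\quad f_{2,3}=f_{3,2}=-(\alpha-\beta)\delta_1\mathfrak m_1\mathfrak a_2\mathfrak a_3. \end{align*} Then $f$ is Hermitian on $[-\pi,\pi]^3$ and $\{n\,\mathcal{A}^{p,\alpha,\beta}_{\bm n}\}_{\bm n}\sim_\lambda(f,[-\pi,\pi]^3)$,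 i.e. with $d_{\bm n}=3\prod_{l=1}^3(n_l+p-2)\to\infty$, for every continuous $F:\mathbb{C}\to\mathbb{C}$ with compact support, $$\lim_{n\to\infty}\frac1{d_{\bm n}}\sum_{j=1}^{d_{\bm n}}F\big(\lambda_j(n\,\mathcal{A}^{p,\alpha,\beta}_{\bm n})\big)=\frac1{(2\pi)^3}\int_{[-\pi,\pi]^3}\frac{\sum_{i=1}^3F(\lambda_i(f(\bm\theta)))}{3}\,d\bm\theta,$$ eigenvalues being counted with algebraic multiplicity. -/

import Mathlib

open Real Filter Topology MeasureTheory
open scoped Kronecker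

noncomputable section

/-! ### B-splines -/

/-- The open uniform knots `ξ_1, …, ξ_{2p+n+1}` of degree `p` over `n` intervals of `[0,1]`:
`ξ_j = 0` for `j ≤ p+1`, `ξ_{i+p+1} = i/n` for `0 ≤ i ≤ n`, and `ξ_j = 1` for `j ≥ p+n+1`. -/
def knot (p n j : ℕ) : ℝ :=
  if j ≤ p + 1 then 0 else if j ≤ p + n then ((j : ℝ) - (p + 1)) / n else 1

/-- `bspline p n k i` is the B-spline `N_i^k` (degree `k`) over the knots `knot p n`.
A fraction with zero denominator is zero, which is also the convention of division in `ℝ`. -/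
def bspline (p n : ℕ) : ℕ → ℕ → ℝ → ℝ
  | 0, i, x => if knot p n i ≤ x ∧ x < knot p n (i + 1) then 1 else 0
  | k + 1, i, x =>
      (x - knot p n i) / (knot p n (i + (k + 1)) - knot p n i) * bspline p n k i x
      + (knot p n (i + (k + 1) + 1) - x) / (knot p n (i + (k + 1) + 1) - knot p n (i + 1))
          * bspline p n k (i + 1) x

/-- The cardinal B-spline `φ_p`. -/
def cardinalBSpline : ℕ → ℝ → ℝ
  | 0, t => if 0 ≤ t ∧ t < 1 then 1 else 0
  | p + 1, t =>
      t / ((p : ℝ) + 1) * cardinalBSpline p t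
      + (((p : ℝ) + 1) + 1 - t) / ((p : ℝ) + 1) * cardinalBSpline p (t - 1)

/-! ### Mass, advection and stiffness matrices

The rows and columns are numbered from `0` here, so that the index `i` stands for `N_{i+2}^p`,
which runs through `N_2^p, …, N_{n+p-1}^p`. -/

/-- The mass matrix `M_n^p`. -/
def massMatrix (p n : ℕ) : Matrix (Fin (n + p - 2)) (Fin (n + p - 2)) ℝ :=
  Matrix.of fun i j =>
    ∫ x in (0 : ℝ)..1, bspline p n p ((i : ℕ) + 2) x * bspline p n p ((j : ℕ) + 2) x

/-- The advection matrix `A_n^p`. -/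
def advectionMatrix (p n : ℕ) : Matrix (Fin (n + p - 2)) (Fin (n + p - 2)) ℝ :=
  Matrix.of fun i j =>
    ∫ x in (0 : ℝ)..1, bspline p n p ((i : ℕ) + 2) x * deriv (bspline p n p ((j : ℕ) + 2)) x

/-- The stiffness matrix `S_n^p`. -/
def stiffnessMatrix (p n : ℕ) : Matrix (Fin (n + p - 2)) (Fin (n + p - 2)) ℝ :=
  Matrix.of fun i j =>
    ∫ x in (0 : ℝ)..1,
      deriv (bspline p n p ((i : ℕ) + 2)) x * deriv (bspline p n p ((j : ℕ) + 2)) x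

/-! ### The matrix of the curl-div operator in three dimensions -/

/-- Index set of the tensor-product B-splines in three dimensions that vanish on the boundary. -/
abbrev SplineIndex (p n₁ n₂ n₃ : ℕ) : Type :=
  Fin (n₁ + p - 2) × Fin (n₂ + p - 2) × Fin (n₃ + p - 2)

/-- The blocks of the discretized operator `(curl ·, curl ·)`. -/
def curlBlocks (p n₁ n₂ n₃ : ℕ) :
    Matrix (Fin 3) (Fin 3) (Matrix (SplineIndex p n₁ n₂ n₃) (SplineIndex p n₁ n₂ n₃) ℝ) :=
  let M₁ := massMatrix p n₁
  let M₂ := massMatrix p n₂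
  let M₃ := massMatrix p n₃
  let A₁ := advectionMatrix p n₁
  let A₂ := advectionMatrix p n₂
  let A₃ := advectionMatrix p n₃
  let S₁ := stiffnessMatrix p n₁
  let S₂ := stiffnessMatrix p n₂
  let S₃ := stiffnessMatrix p n₃
  !![M₁ ⊗ₖ (M₂ ⊗ₖ S₃) + M₁ ⊗ₖ (S₂ ⊗ₖ M₃),
       -(A₁.transpose ⊗ₖ (A₂ ⊗ₖ M₃)),
       -(A₁.transpose ⊗ₖ (M₂ ⊗ₖ A₃));
     -(A₁ ⊗ₖ (A₂.transpose ⊗ₖ M₃)),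
       S₁ ⊗ₖ (M₂ ⊗ₖ M₃) + M₁ ⊗ₖ (M₂ ⊗ₖ S₃),
       -(M₁ ⊗ₖ (A₂.transpose ⊗ₖ A₃));
     -(A₁ ⊗ₖ (M₂ ⊗ₖ A₃.transpose)),
       -(M₁ ⊗ₖ (A₂ ⊗ₖ A₃.transpose)),
       S₁ ⊗ₖ (M₂ ⊗ₖ M₃) + M₁ ⊗ₖ (S₂ ⊗ₖ M₃)]

/-- The blocks of the discretized operator `(div ·, div ·)`. -/
def divBlocks (p n₁ n₂ n₃ : ℕ) :
    Matrix (Fin 3) (Fin 3) (Matrix (SplineIndex p n₁ n₂ n₃) (SplineIndex p n₁ n₂ n₃) ℝ) :=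
  let M₁ := massMatrix p n₁
  let M₂ := massMatrix p n₂
  let M₃ := massMatrix p n₃
  let A₁ := advectionMatrix p n₁
  let A₂ := advectionMatrix p n₂
  let A₃ := advectionMatrix p n₃
  let S₁ := stiffnessMatrix p n₁
  let S₂ := stiffnessMatrix p n₂
  let S₃ := stiffnessMatrix p n₃
  !![S₁ ⊗ₖ (M₂ ⊗ₖ M₃),
       A₁ ⊗ₖ (A₂.transpose ⊗ₖ M₃),
       A₁ ⊗ₖ (M₂ ⊗ₖ A₃.transpose);
     A₁.transpose ⊗ₖ (A₂ ⊗ₖ M₃),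
       M₁ ⊗ₖ (S₂ ⊗ₖ M₃),
       M₁ ⊗ₖ (A₂ ⊗ₖ A₃.transpose);
     A₁.transpose ⊗ₖ (M₂ ⊗ₖ A₃),
       M₁ ⊗ₖ (A₂.transpose ⊗ₖ A₃),
       M₁ ⊗ₖ (M₂ ⊗ₖ S₃)]

/-- The `3 × 3` block matrix `𝒜_𝐧^{p,α,β} = α 𝒜_𝐧^{p,curl} + β 𝒜_𝐧^{p,div}`, of size
`3 (n₁+p-2) (n₂+p-2) (n₃+p-2)`. -/
def curlDivMatrix (p : ℕ) (α β : ℝ) (n₁ n₂ n₃ : ℕ) :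
    Matrix (Fin 3 × SplineIndex p n₁ n₂ n₃) (Fin 3 × SplineIndex p n₁ n₂ n₃) ℝ :=
  α • Matrix.comp _ _ _ _ ℝ (curlBlocks p n₁ n₂ n₃)
    + β • Matrix.comp _ _ _ _ ℝ (divBlocks p n₁ n₂ n₃)

/-! ### The symbol -/

/-- `𝔪_p`. -/
def massSymbol (p : ℕ) (θ : ℝ) : ℝ :=
  cardinalBSpline (2 * p + 1) ((p : ℝ) + 1)
    + 2 * ∑ k ∈ Finset.Icc 1 p,
        cardinalBSpline (2 * p + 1) ((p : ℝ) + 1 - k) * Real.cos (k * θ)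

/-- `𝔞_p`. -/
def advectionSymbol (p : ℕ) (θ : ℝ) : ℝ :=
  -2 * ∑ k ∈ Finset.Icc 1 p,
    deriv (cardinalBSpline (2 * p + 1)) ((p : ℝ) + 1 - k) * Real.sin (k * θ)

/-- `𝔰_p`. -/
def stiffnessSymbol (p : ℕ) (θ : ℝ) : ℝ :=
  -(iteratedDeriv 2 (cardinalBSpline (2 * p + 1)) ((p : ℝ) + 1))
    - 2 * ∑ k ∈ Finset.Icc 1 p,
        iteratedDeriv 2 (cardinalBSpline (2 * p + 1)) ((p : ℝ) + 1 - k) * Real.cos (k * θ)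

/-- `γ_i = ν_i² / (ν₁ ν₂ ν₃)`. -/
def symbolGamma (ν : Fin 3 → ℚ) (i : Fin 3) : ℝ := (ν i : ℝ) ^ 2 / (ν 0 * ν 1 * ν 2)

/-- `δ_i = 1 / ν_i`. -/
def symbolDelta (ν : Fin 3 → ℚ) (i : Fin 3) : ℝ := 1 / (ν i : ℝ)

/-- The `3 × 3` symbol `f^{p,α,β}`; the directions `1, 2, 3` are numbered `0, 1, 2`. -/
def curlDivSymbol (p : ℕ) (α β : ℝ) (ν : Fin 3 → ℚ) (θ : Fin 3 → ℝ) :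
    Matrix (Fin 3) (Fin 3) ℂ :=
  let m : Fin 3 → ℝ := fun i => massSymbol p (θ i)
  let a : Fin 3 → ℝ := fun i => advectionSymbol p (θ i)
  let s : Fin 3 → ℝ := fun i => stiffnessSymbol p (θ i)
  let γ : Fin 3 → ℝ := symbolGamma ν
  let δ : Fin 3 → ℝ := symbolDelta ν
  let f₁₁ : ℝ := β * γ 0 * s 0 * m 1 * m 2 + α * γ 1 * m 0 * s 1 * m 2 + α * γ 2 * m 0 * m 1 * s 2
  let f₁₂ : ℝ := -(α - β) * δ 2 * a 0 * a 1 * m 2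
  let f₁₃ : ℝ := -(α - β) * δ 1 * a 0 * m 1 * a 2
  let f₂₂ : ℝ := α * γ 0 * s 0 * m 1 * m 2 + β * γ 1 * m 0 * s 1 * m 2 + α * γ 2 * m 0 * m 1 * s 2
  let f₂₃ : ℝ := -(α - β) * δ 0 * m 0 * a 1 * a 2
  let f₃₃ : ℝ := α * γ 0 * s 0 * m 1 * m 2 + α * γ 1 * m 0 * s 1 * m 2 + β * γ 2 * m 0 * m 1 * s 2
  !![(f₁₁ : ℂ), (f₁₂ : ℂ), (f₁₃ : ℂ);
     (f₁₂ : ℂ), (f₂₂ : ℂ), (f₂₃ : ℂ);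
     (f₁₃ : ℂ), (f₂₃ : ℂ), (f₃₃ : ℂ)]

/-! ### Spectral distribution -/

/-- `∑_j F(λ_j(A))` over the eigenvalues of `A`, counted with algebraic multiplicity. -/
def eigenvalueSum {ι : Type*} [Fintype ι] [DecidableEq ι] (F : ℂ → ℂ) (A : Matrix ι ι ℂ) : ℂ :=
  (A.charpoly.roots.map F).sum

/-- `{A_k}_k ∼_λ (f, G)` as `k` tends to infinity along the filter `l`: the matrix-sequence is
distributed as the pair `(f, G)` in the sense of the eigenvalues. The first conjuncts are the
requirements of the definition on `G`, on `f` and on the dimensions. -/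
def EigenvalueDistributed {κ : Type*} (l : Filter κ) {ι : κ → Type*}
    [∀ k, Fintype (ι k)] [∀ k, DecidableEq (ι k)] (A : ∀ k, Matrix (ι k) (ι k) ℂ)
    {q s : ℕ} (f : (Fin q → ℝ) → Matrix (Fin s) (Fin s) ℂ) (G : Set (Fin q → ℝ)) : Prop :=
  MeasurableSet G ∧ 0 < volume G ∧ volume G < ⊤ ∧
  (∀ i j, Measurable fun t : G => f t i j) ∧
  Tendsto (fun k => Fintype.card (ι k)) l atTop ∧
  ∀ F : ℂ → ℂ, Continuous F → HasCompactSupport F →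
    IntegrableOn (fun t => eigenvalueSum F (f t) / (s : ℂ)) G ∧
    Tendsto (fun k => 1 / (Fintype.card (ι k) : ℂ) * eigenvalueSum F (A k)) l
      (𝓝 (1 / (volume.real G : ℂ) * ∫ t in G, eigenvalueSum F (f t) / (s : ℂ)))

/-- The positive integers `n` for which `n ν` is a multi-index, i.e. `n ν_i ∈ ℕ` for all `i`. -/
abbrev AdmissibleScale (ν : Fin 3 → ℚ) : Type :=
  {n : ℕ // 0 < n ∧ ∀ i, ∃ k : ℕ, (n : ℚ) * ν i = k}

/-- The `i`-th component `n ν_i ∈ ℕ` of `𝐧 = n ν`; the floor only changes the type. -/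
def scaledIndex (ν : Fin 3 → ℚ) (n : AdmissibleScale ν) (i : Fin 3) : ℕ :=
  ⌊((n : ℕ) : ℚ) * ν i⌋₊

end

/-!
The proof is by the method of moments. The matrices `n 𝒜` are real symmetric and their row sums are
bounded independently of `n`, so all their eigenvalues lie in one compact interval. On this interval
a continuous `F` is a uniform limit of polynomials, and `∑_j λ_j ^ m` is the trace of the `m`-th
power. It therefore suffices that for every `m` the normalized traces of `(n 𝒜) ^ m` converge to
the mean over the cube of the normalized trace of `f ^ m`
(`eigenvalueDistributed_of_tendsto_trace_pow`).

For the traces, no perturbation theory is needed. The matrices `n M`, `A`, `n⁻¹ S` are banded with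
bounded entries, and away from the first and last few rows they are *exactly* Toeplitz
(`IsInteriorToeplitz`), since there the B-splines are shifts of one cardinal B-spline
(`bspline_eq_cardinalBSpline`). Their Toeplitz coefficients are values of the cardinal B-spline of
degree `2p + 1` and of its derivatives, because cardinal B-splines convolve to cardinal B-splines
(`integral_cardinalBSpline_mul_comp_sub`) and differentiate to differences of cardinal B-splines.
So `n 𝒜`, a sum of nine tensor products of these matrices, is banded and block multilevel Toeplitz
away from the boundary of the grid, with coefficients the Fourier coefficients of `f`
(`curlDivSymbol_eq_trigPoly`). Products of banded matrices only look at neighbouring rows, hence the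
rows of `(n 𝒜) ^ m` at distance `O(m p)` from the boundary hold exactly the Fourier coefficients of
`f ^ m` (`pow_apply_eq_fourier_of_isDeep`). The remaining rows are a vanishing fraction of all rows
and contribute boundedly to the trace (`norm_trace_pow_sub_le`).
-/

/-! ### Cardinal B-splines -/

theorem cardinalBSpline_succ (q : ℕ) (t : ℝ) :
    cardinalBSpline (q + 1) t = t / ((q : ℝ) + 1) * cardinalBSpline q t
      + (((q : ℝ) + 1) + 1 - t) / ((q : ℝ) + 1) * cardinalBSpline q (t - 1) := rfl

theorem cardinalBSpline_of_neg (q : ℕ) {t : ℝ} (ht : t < 0) : cardinalBSpline q t = 0 := by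
  induction q generalizing t with
  | zero => simp [cardinalBSpline, not_le.2 ht]
  | succ q ih => rw [cardinalBSpline_succ, ih ht, ih (by linarith)]; simp

theorem cardinalBSpline_of_ge (q : ℕ) {t : ℝ} (ht : (q : ℝ) + 1 ≤ t) :
    cardinalBSpline q t = 0 := by
  induction q generalizing t with
  | zero => simp at ht; simp [cardinalBSpline, ht]
  | succ q ih =>
    push_cast at ht
    rw [cardinalBSpline_succ, ih (by linarith), ih (by linarith)]; simp

theorem abs_cardinalBSpline_le (q : ℕ) (t : ℝ) : |cardinalBSpline q t| ≤ 2 ^ q := by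
  induction q generalizing t with
  | zero => simp only [cardinalBSpline]; split_ifs <;> simp
  | succ q ih =>
    have hq : (0 : ℝ) < (q : ℝ) + 1 := by positivity
    have key : ∀ r s : ℝ, (0 ≤ s → s ≤ q + 1 → 0 ≤ r ∧ r ≤ q + 1) →
        |r / ((q : ℝ) + 1) * cardinalBSpline q s| ≤ 2 ^ q := by
      intro r s h
      rcases lt_or_ge s 0 with h0 | h0
      · simp [cardinalBSpline_of_neg q h0]
      rcases le_or_gt ((q : ℝ) + 1) s with h1 | h1
      · simp [cardinalBSpline_of_ge q h1]
      obtain ⟨hr0, hr1⟩ := h h0 h1.le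
      rw [abs_mul, abs_of_nonneg (by positivity)]
      calc r / ((q : ℝ) + 1) * |cardinalBSpline q s| ≤ 1 * 2 ^ q := by
            gcongr
            · exact (div_le_one hq).2 hr1
            · exact ih s
        _ = _ := one_mul _
    rw [cardinalBSpline_succ]
    calc _ ≤ _ := abs_add_le _ _
      _ ≤ 2 ^ q + 2 ^ q := add_le_add (key _ _ fun h1 h2 => ⟨h1, h2⟩)
          (key _ _ fun h1 h2 => ⟨by linarith, by linarith⟩)
      _ = _ := by ring

theorem cardinalBSpline_one : cardinalBSpline 1 = fun t => max 0 (min t (2 - t)) := by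
  funext t
  rw [cardinalBSpline_succ]
  simp only [cardinalBSpline, Nat.cast_zero]
  rcases lt_or_ge t 0 with h0 | h0
  · rw [if_neg (by intro h; linarith [h.1]), if_neg (by intro h; linarith [h.1]),
      min_eq_left (by linarith), max_eq_left h0.le]; simp
  rcases lt_or_ge t 1 with h1 | h1
  · rw [if_pos ⟨h0, h1⟩, if_neg (by intro h; linarith [h.1]),
      min_eq_left (by linarith), max_eq_right h0]; simp
  rcases lt_or_ge t 2 with h2 | h2
  · rw [if_neg (by intro h; linarith [h.2]), if_pos ⟨by linarith, by linarith⟩,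
      min_eq_right (by linarith), max_eq_right (by linarith)]; ring
  · rw [if_neg (by intro h; linarith [h.2]), if_neg (by intro h; linarith [h.2]),
      min_eq_right (by linarith), max_eq_left (by linarith)]; simp

theorem continuous_cardinalBSpline {q : ℕ} (hq : 1 ≤ q) : Continuous (cardinalBSpline q) := by
  induction q, hq using Nat.le_induction with
  | base => rw [cardinalBSpline_one]; fun_prop
  | succ q _ ih =>
    have : cardinalBSpline (q + 1) = fun t => t / ((q : ℝ) + 1) * cardinalBSpline q t
      + (((q : ℝ) + 1) + 1 - t) / ((q : ℝ) + 1) * cardinalBSpline q (t - 1) := rfl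
    rw [this]
    fun_prop

theorem cardinalBSpline_zero_eq_indicator :
    cardinalBSpline 0 = (Set.Ico (0 : ℝ) 1).indicator 1 := by
  funext t
  simp [cardinalBSpline, Set.indicator_apply]

theorem integrable_cardinalBSpline (q : ℕ) : Integrable (cardinalBSpline q) := by
  rcases Nat.eq_zero_or_pos q with rfl | hq
  · rw [cardinalBSpline_zero_eq_indicator, integrable_indicator_iff measurableSet_Ico]
    exact integrableOn_const (by simp)
  · refine (continuous_cardinalBSpline hq).integrable_of_hasCompactSupport
      (HasCompactSupport.intro (isCompact_Icc (a := (0 : ℝ)) (b := (q : ℝ) + 1)) fun t ht => ?_)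
    rw [Set.mem_Icc, not_and_or, not_le, not_le] at ht
    exact ht.elim (cardinalBSpline_of_neg q) fun h => cardinalBSpline_of_ge q h.le

theorem sub_one_notMem_range_intCast {t : ℝ} (ht : t ∉ Set.range ((↑) : ℤ → ℝ)) :
    t - 1 ∉ Set.range ((↑) : ℤ → ℝ) := by
  rintro ⟨z, hz⟩
  exact ht ⟨z + 1, by push_cast; linarith⟩

theorem hasDerivAt_cardinalBSpline_zero {t : ℝ} (ht : t ∉ Set.range ((↑) : ℤ → ℝ)) :
    HasDerivAt (cardinalBSpline 0) 0 t := by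
  rcases lt_or_ge t 0 with h0 | h0
  · refine (hasDerivAt_const t (0 : ℝ)).congr_of_eventuallyEq ?_
    filter_upwards [eventually_lt_nhds h0] with x hx using cardinalBSpline_of_neg 0 hx
  have h0' : 0 < t := lt_of_le_of_ne h0 fun h => ht ⟨0, by simpa using h⟩
  rcases lt_or_ge t 1 with h1 | h1
  · refine (hasDerivAt_const t (1 : ℝ)).congr_of_eventuallyEq ?_
    filter_upwards [eventually_lt_nhds h1, eventually_gt_nhds h0'] with x hx hx'
    simp [cardinalBSpline, hx, hx'.le]
  · have h1' : 1 < t := lt_of_le_of_ne h1 fun h => ht ⟨1, by simpa using h⟩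
    refine (hasDerivAt_const t (0 : ℝ)).congr_of_eventuallyEq ?_
    filter_upwards [eventually_gt_nhds h1'] with x hx using
      cardinalBSpline_of_ge 0 (by simpa using hx.le)

/-- Off the integers this follows from the recursion in every degree, including degree one, where
the derivative does not exist at the integers. -/
theorem hasDerivAt_cardinalBSpline_of_notMem (q : ℕ) {t : ℝ}
    (ht : t ∉ Set.range ((↑) : ℤ → ℝ)) :
    HasDerivAt (cardinalBSpline (q + 1)) (cardinalBSpline q t - cardinalBSpline q (t - 1)) t := by
  have key : ∀ {q : ℕ} {t a b : ℝ}, HasDerivAt (cardinalBSpline q) a t →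
      HasDerivAt (cardinalBSpline q) b (t - 1) → HasDerivAt (cardinalBSpline (q + 1))
        ((cardinalBSpline q t - cardinalBSpline q (t - 1) + t * a + ((q : ℝ) + 2 - t) * b)
          / ((q : ℝ) + 1)) t := by
    intro q t a b ha hb
    have hb' : HasDerivAt (fun x => cardinalBSpline q (x - 1)) b t := hb.comp_sub_const t 1
    have h := (((hasDerivAt_id t).div_const ((q : ℝ) + 1)).mul ha).add
      ((((hasDerivAt_const t ((q : ℝ) + 1 + 1)).sub (hasDerivAt_id t)).div_const
        ((q : ℝ) + 1)).mul hb')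
    have hq : (q : ℝ) + 1 ≠ 0 := by positivity
    refine h.congr_deriv ?_
    simp only [id, Pi.sub_apply]
    field_simp
    ring
  induction q generalizing t with
  | zero =>
    exact (key (hasDerivAt_cardinalBSpline_zero ht)
      (hasDerivAt_cardinalBSpline_zero (sub_one_notMem_range_intCast ht))).congr_deriv (by simp)
  | succ q ih =>
    have hq : (q : ℝ) + 1 ≠ 0 := by positivity
    have hq' : (q : ℝ) + 1 + 1 ≠ 0 := by positivity
    refine (key (ih ht) (ih (sub_one_notMem_range_intCast ht))).congr_deriv ?_
    rw [cardinalBSpline_succ q t, cardinalBSpline_succ q (t - 1)]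
    push_cast
    field_simp
    ring

theorem intervalIntegral_cardinalBSpline (q : ℕ) (t : ℝ) :
    ∫ r in (t - 1)..t, cardinalBSpline q r = cardinalBSpline (q + 1) t := by
  have hint : ∀ a b : ℝ, IntervalIntegrable (cardinalBSpline q) volume a b := fun a b =>
    (integrable_cardinalBSpline q).intervalIntegrable
  have hint' : ∀ a b : ℝ, IntervalIntegrable (fun r => cardinalBSpline q (r - 1)) volume a b :=
    fun a b => ((integrable_cardinalBSpline q).comp_sub_right 1).intervalIntegrable
  -- Any lower limit left of the support will do; `-1` is one where all terms vanish pointwise.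
  have h := integral_eq_of_hasDerivAt_off_countable (cardinalBSpline (q + 1))
    (fun r => cardinalBSpline q r - cardinalBSpline q (r - 1))
    (Set.countable_range ((↑) : ℤ → ℝ)) (a := -1) (b := t)
    (continuous_cardinalBSpline (by omega)).continuousOn
    (fun x hx => hasDerivAt_cardinalBSpline_of_notMem q hx.2) ((hint _ _).sub (hint' _ _))
  rw [intervalIntegral.integral_sub (hint _ _) (hint' _ _),
    intervalIntegral.integral_comp_sub_right (fun r => cardinalBSpline q r) 1,
    cardinalBSpline_of_neg (q + 1) (by norm_num : (-1 : ℝ) < 0), sub_zero] at h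
  have h0 : ∫ r in (-1 - 1 : ℝ)..(-1), cardinalBSpline q r = 0 := by
    rw [intervalIntegral.integral_congr (g := fun _ => (0 : ℝ))]
    · simp
    · intro r hr
      rw [Set.uIcc_of_le (by norm_num)] at hr
      exact cardinalBSpline_of_neg q (by linarith [hr.2])
  have h1 := intervalIntegral.integral_add_adjacent_intervals (hint (-1 - 1) (-1)) (hint (-1) t)
  have h2 := intervalIntegral.integral_add_adjacent_intervals (hint (-1 - 1) (t - 1))
    (hint (t - 1) t)
  linarith

theorem hasDerivAt_cardinalBSpline {q : ℕ} (hq : 1 ≤ q) (t : ℝ) :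
    HasDerivAt (cardinalBSpline (q + 1)) (cardinalBSpline q t - cardinalBSpline q (t - 1)) t := by
  have hc := continuous_cardinalBSpline hq
  have hF : ∀ s : ℝ, HasDerivAt (fun u => ∫ r in (0 : ℝ)..u, cardinalBSpline q r)
      (cardinalBSpline q s) s := fun s => (hc.integral_hasStrictDerivAt 0 s).hasDerivAt
  have h := (hF t).sub ((hF (t - 1)).comp_sub_const t 1)
  refine h.congr_of_eventuallyEq (Eventually.of_forall fun u => ?_)
  rw [← intervalIntegral_cardinalBSpline]
  exact (intervalIntegral.integral_interval_sub_left (hc.intervalIntegrable _ _)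
    (hc.intervalIntegrable _ _)).symm

theorem deriv_cardinalBSpline {q : ℕ} (hq : 1 ≤ q) :
    deriv (cardinalBSpline (q + 1)) =
      fun t => cardinalBSpline q t - cardinalBSpline q (t - 1) :=
  funext fun t => (hasDerivAt_cardinalBSpline hq t).deriv

theorem iteratedDeriv_two_cardinalBSpline {q : ℕ} (hq : 1 ≤ q) (t : ℝ) :
    iteratedDeriv 2 (cardinalBSpline (q + 2)) t =
      cardinalBSpline q t - 2 * cardinalBSpline q (t - 1) + cardinalBSpline q (t - 2) := by
  rw [iteratedDeriv_succ, iteratedDeriv_one, deriv_cardinalBSpline (by omega : 1 ≤ q + 1)]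
  refine (((hasDerivAt_cardinalBSpline hq t).sub
    ((hasDerivAt_cardinalBSpline hq (t - 1)).comp_sub_const t 1)).congr_deriv ?_).deriv
  rw [show t - 1 - 1 = t - 2 by ring]
  ring

/-! ### Symmetry and inner products of cardinal B-splines -/

/-- In degree zero the symmetry fails at `0` and `1`, hence the exclusion of the integers. -/
theorem cardinalBSpline_symm_of_notMem (q : ℕ) {t : ℝ} (ht : t ∉ Set.range ((↑) : ℤ → ℝ)) :
    cardinalBSpline q ((q : ℝ) + 1 - t) = cardinalBSpline q t := by
  induction q generalizing t with
  | zero =>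
    have h0 : t ≠ 0 := fun h => ht ⟨0, by simp [h]⟩
    have h1 : t ≠ 1 := fun h => ht ⟨1, by simp [h]⟩
    have : (0 ≤ 1 - t ∧ 1 - t < 1) ↔ (0 ≤ t ∧ t < 1) :=
      ⟨fun h => ⟨by linarith [h.2], lt_of_le_of_ne (by linarith [h.1]) h1⟩,
        fun h => ⟨by linarith [h.2], by linarith [lt_of_le_of_ne h.1 h0.symm]⟩⟩
    simp only [cardinalBSpline, Nat.cast_zero, zero_add, this]
  | succ q ih =>
    have h1 := ih ht
    have h2 := ih (sub_one_notMem_range_intCast ht)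
    rw [cardinalBSpline_succ, cardinalBSpline_succ q t, ← h1, ← h2]
    push_cast
    rw [show (q : ℝ) + 1 + 1 - t - 1 = q + 1 - t by ring,
      show (q : ℝ) + 1 - (t - 1) = q + 1 + 1 - t by ring]
    ring

theorem ae_notMem_range_intCast : ∀ᵐ t : ℝ, t ∉ Set.range ((↑) : ℤ → ℝ) :=
  (Set.countable_range _).ae_notMem _

theorem cardinalBSpline_symm {q : ℕ} (hq : 1 ≤ q) (t : ℝ) :
    cardinalBSpline q ((q : ℝ) + 1 - t) = cardinalBSpline q t := by
  have hc := continuous_cardinalBSpline hq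
  -- Continuous functions that agree almost everywhere are equal.
  have h : (fun t => cardinalBSpline q ((q : ℝ) + 1 - t)) = cardinalBSpline q :=
    (Continuous.ae_eq_iff_eq volume (by fun_prop) hc).1
      (ae_notMem_range_intCast.mono fun t ht => cardinalBSpline_symm_of_notMem q ht)
  exact congrFun h t

/-- The convolution of the cardinal B-splines of degrees `p` and `q` is the one of degree
`p + q + 1`. -/
theorem integral_cardinalBSpline_mul_comp_sub (p q : ℕ) (s : ℝ) :
    ∫ t, cardinalBSpline p t * cardinalBSpline q (s - t) = cardinalBSpline (p + q + 1) s := by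
  induction q generalizing s with
  | zero =>
    have : (fun t => cardinalBSpline p t * cardinalBSpline 0 (s - t)) =
        (Set.Ioc (s - 1) s).indicator (cardinalBSpline p) := by
      funext t
      have : (0 ≤ s - t ∧ s - t < 1) ↔ t ∈ Set.Ioc (s - 1) s := by
        rw [Set.mem_Ioc]
        constructor <;> rintro ⟨h1, h2⟩ <;> constructor <;> linarith
      simp only [cardinalBSpline, Set.indicator_apply, this, mul_ite, mul_one, mul_zero]
    rw [this, integral_indicator measurableSet_Ioc,
      ← intervalIntegral.integral_of_le (by linarith), intervalIntegral_cardinalBSpline]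
  | succ q ih =>
    have hle : s - 1 ≤ s := by linarith
    have h1 : ∀ t, cardinalBSpline p t * cardinalBSpline (q + 1) (s - t) =
        ∫ r in Set.Ioc (s - 1) s, cardinalBSpline p t * cardinalBSpline q (r - t) := by
      intro t
      rw [← intervalIntegral.integral_of_le hle, intervalIntegral.integral_const_mul,
        intervalIntegral.integral_comp_sub_right (fun r => cardinalBSpline q r) t,
        ← intervalIntegral_cardinalBSpline, sub_right_comm]
    -- Fubini: the moving average of a convolution is the convolution with the moving average.
    simp_rw [h1]
    rw [integral_integral_swap]
    · simp_rw [ih]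
      rw [← intervalIntegral.integral_of_le hle, intervalIntegral_cardinalBSpline]
      rfl
    · have h := (integrable_cardinalBSpline p).convolution_integrand
        (ContinuousLinearMap.mul ℝ ℝ) (integrable_cardinalBSpline q)
      have h' := (h.integrableOn (s := Set.Ioc (s - 1) s ×ˢ Set.univ))
      rw [IntegrableOn, ← Measure.prod_restrict, Measure.restrict_univ] at h'
      exact h'.swap

theorem integral_cardinalBSpline_mul_shift (p q : ℕ) (k : ℝ) :
    ∫ t, cardinalBSpline p t * cardinalBSpline q (t - k) =
      cardinalBSpline (p + q + 1) ((q : ℝ) + 1 + k) := by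
  rw [← integral_cardinalBSpline_mul_comp_sub]
  refine integral_congr_ae ?_
  have h : ∀ᵐ t : ℝ, t - k ∉ Set.range ((↑) : ℤ → ℝ) :=
    (measurePreserving_sub_right volume k).quasiMeasurePreserving.ae ae_notMem_range_intCast
  filter_upwards [h] with t ht
  rw [← cardinalBSpline_symm_of_notMem q ht]
  congr 2
  ring

theorem integrable_cardinalBSpline_mul_shift (p q : ℕ) (a b : ℝ) :
    Integrable fun t => cardinalBSpline p (t - a) * cardinalBSpline q (t - b) :=
  ((integrable_cardinalBSpline q).comp_sub_right b).bdd_mul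
    ((integrable_cardinalBSpline p).comp_sub_right a).aestronglyMeasurable
    (Eventually.of_forall fun t => abs_cardinalBSpline_le p (t - a))

theorem integral_cardinalBSpline_mul_shift_shift (p q : ℕ) (a b : ℝ) :
    ∫ t, cardinalBSpline p (t - a) * cardinalBSpline q (t - b) =
      cardinalBSpline (p + q + 1) ((q : ℝ) + 1 + (b - a)) := by
  rw [← integral_cardinalBSpline_mul_shift,
    ← integral_sub_right_eq_self (fun t => cardinalBSpline p t * cardinalBSpline q (t - (b - a))) a]
  simp only [sub_sub, add_sub_cancel]

/-- The Gram matrix of the shifts of a cardinal B-spline. -/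
theorem integral_cardinalBSpline_mass {p : ℕ} (a b : ℝ) :
    ∫ t, cardinalBSpline p (t - a) * cardinalBSpline p (t - b) =
      cardinalBSpline (2 * p + 1) ((p : ℝ) + 1 - (a - b)) := by
  rw [integral_cardinalBSpline_mul_shift_shift, ← two_mul]
  congr 1
  ring

theorem ae_deriv_cardinalBSpline_sub (q : ℕ) (a : ℝ) :
    ∀ᵐ t : ℝ, deriv (cardinalBSpline (q + 1)) (t - a) =
      cardinalBSpline q (t - a) - cardinalBSpline q (t - (a + 1)) := by
  have h : ∀ᵐ t : ℝ, t - a ∉ Set.range ((↑) : ℤ → ℝ) :=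
    (measurePreserving_sub_right volume a).quasiMeasurePreserving.ae ae_notMem_range_intCast
  filter_upwards [h] with t ht
  rw [(hasDerivAt_cardinalBSpline_of_notMem q ht).deriv, sub_sub]

theorem integral_cardinalBSpline_advection {p : ℕ} (hp : 1 ≤ p) (a b : ℝ) :
    ∫ t, cardinalBSpline p (t - a) * deriv (cardinalBSpline p) (t - b) =
      -deriv (cardinalBSpline (2 * p + 1)) ((p : ℝ) + 1 - (a - b)) := by
  obtain ⟨q, rfl⟩ : ∃ q, p = q + 1 := ⟨p - 1, by omega⟩
  have hae : (fun t => cardinalBSpline (q + 1) (t - a) * deriv (cardinalBSpline (q + 1)) (t - b))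
      =ᵐ[volume] fun t => cardinalBSpline (q + 1) (t - a) * cardinalBSpline q (t - b) -
        cardinalBSpline (q + 1) (t - a) * cardinalBSpline q (t - (b + 1)) := by
    filter_upwards [ae_deriv_cardinalBSpline_sub q b] with t ht
    rw [ht]; ring
  rw [integral_congr_ae hae, integral_sub (integrable_cardinalBSpline_mul_shift _ _ _ _)
    (integrable_cardinalBSpline_mul_shift _ _ _ _), integral_cardinalBSpline_mul_shift_shift,
    integral_cardinalBSpline_mul_shift_shift, deriv_cardinalBSpline (by omega),
    show q + 1 + q + 1 = 2 * (q + 1) by ring]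
  push_cast
  rw [show (q : ℝ) + 1 + 1 - (a - b) - 1 = q + 1 + (b - a) by ring,
    show (q : ℝ) + 1 + 1 - (a - b) = q + 1 + (b + 1 - a) by ring]
  ring

theorem integral_cardinalBSpline_stiffness {p : ℕ} (hp : 1 ≤ p) (a b : ℝ) :
    ∫ t, deriv (cardinalBSpline p) (t - a) * deriv (cardinalBSpline p) (t - b) =
      -iteratedDeriv 2 (cardinalBSpline (2 * p + 1)) ((p : ℝ) + 1 - (a - b)) := by
  obtain ⟨q, rfl⟩ : ∃ q, p = q + 1 := ⟨p - 1, by omega⟩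
  have hae : (fun t => deriv (cardinalBSpline (q + 1)) (t - a) *
      deriv (cardinalBSpline (q + 1)) (t - b)) =ᵐ[volume] fun t =>
        (cardinalBSpline q (t - a) * cardinalBSpline q (t - b) -
          cardinalBSpline q (t - a) * cardinalBSpline q (t - (b + 1))) -
        (cardinalBSpline q (t - (a + 1)) * cardinalBSpline q (t - b) -
          cardinalBSpline q (t - (a + 1)) * cardinalBSpline q (t - (b + 1))) := by
    filter_upwards [ae_deriv_cardinalBSpline_sub q a, ae_deriv_cardinalBSpline_sub q b]
      with t ht ht'
    rw [ht, ht']; ring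
  have hi := integrable_cardinalBSpline_mul_shift q q
  rw [integral_congr_ae hae, integral_sub (by exact (hi _ _).sub (hi _ _))
      (by exact (hi _ _).sub (hi _ _)),
    integral_sub (hi _ _) (hi _ _), integral_sub (hi _ _) (hi _ _),
    show 2 * (q + 1) + 1 = (q + q + 1) + 2 by ring,
    iteratedDeriv_two_cardinalBSpline (by omega)]
  simp only [integral_cardinalBSpline_mul_shift_shift]
  push_cast
  rw [show (q : ℝ) + 1 + 1 - (a - b) - 1 = q + 1 + (b - a) by ring,
    show (q : ℝ) + 1 + 1 - (a - b) - 2 = q + 1 + (b - (a + 1)) by ring,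
    show (q : ℝ) + 1 + 1 - (a - b) = q + 1 + (b + 1 - a) by ring,
    show (q : ℝ) + 1 + (b + 1 - (a + 1)) = q + 1 + (b - a) by ring]
  ring

/-! ### Knots and bounds for B-splines -/

/-- Truncated subtraction and `min` clamp the knot index to `{0, …, n}`. -/
theorem knot_eq_min_div (p : ℕ) {n : ℕ} (hn : 0 < n) (j : ℕ) :
    knot p n j = ((min (j - (p + 1)) n : ℕ) : ℝ) / n := by
  have hn' : (n : ℝ) ≠ 0 := by positivity
  unfold knot
  split_ifs with h1 h2
  · simp [Nat.sub_eq_zero_of_le h1]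
  · rw [min_eq_left (by omega), Nat.cast_sub (by omega)]
    push_cast; rfl
  · rw [min_eq_right (by omega), div_self hn']

theorem knot_mono (p : ℕ) {n : ℕ} (hn : 0 < n) : Monotone (knot p n) := by
  intro i j hij
  rw [knot_eq_min_div p hn, knot_eq_min_div p hn]
  gcongr

theorem knot_add_le (p : ℕ) {n : ℕ} (hn : 0 < n) (i m : ℕ) :
    knot p n (i + m) - knot p n i ≤ (m : ℝ) / n := by
  rw [knot_eq_min_div p hn, knot_eq_min_div p hn, ← sub_div]
  gcongr
  rw [sub_le_iff_le_add]
  norm_cast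
  omega

/-- Distinct knots are at distance at least `1 / n`; for coinciding knots the quotient is zero. -/
theorem inv_sub_knot_le (p : ℕ) {n : ℕ} (hn : 0 < n) {i j : ℕ} (hij : i ≤ j) :
    |1 / (knot p n j - knot p n i)| ≤ n := by
  have hn' : (0 : ℝ) < n := by positivity
  rw [knot_eq_min_div p hn, knot_eq_min_div p hn, ← sub_div, one_div_div]
  have hm : min (i - (p + 1)) n ≤ min (j - (p + 1)) n := by gcongr
  rcases hm.eq_or_lt with h | h
  · simp [h]
  · have : (1 : ℝ) ≤ ((min (j - (p + 1)) n : ℕ) : ℝ) - ((min (i - (p + 1)) n : ℕ) : ℝ) := by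
      rw [le_sub_iff_add_le']; exact_mod_cast h
    rw [abs_of_nonneg (by positivity)]
    exact div_le_self hn'.le this

theorem bspline_succ (p n k i : ℕ) (x : ℝ) : bspline p n (k + 1) i x =
      (x - knot p n i) / (knot p n (i + (k + 1)) - knot p n i) * bspline p n k i x
      + (knot p n (i + (k + 1) + 1) - x) / (knot p n (i + (k + 1) + 1) - knot p n (i + 1))
          * bspline p n k (i + 1) x := rfl

theorem bspline_of_lt (p : ℕ) {n : ℕ} (hn : 0 < n) (k : ℕ) {i : ℕ} {x : ℝ}
    (hx : x < knot p n i) : bspline p n k i x = 0 := by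
  induction k generalizing i with
  | zero => simp [bspline, not_le.2 hx]
  | succ k ih =>
    rw [bspline_succ, ih hx, ih (hx.trans_le (knot_mono p hn (Nat.le_succ i)))]; simp

theorem bspline_of_ge (p : ℕ) {n : ℕ} (hn : 0 < n) (k : ℕ) {i : ℕ} {x : ℝ}
    (hx : knot p n (i + k + 1) ≤ x) : bspline p n k i x = 0 := by
  induction k generalizing i with
  | zero => simp [bspline, not_lt.2 hx]
  | succ k ih =>
    rw [bspline_succ, ih ((knot_mono p hn (by omega)).trans hx),
      ih ((knot_mono p hn (by omega)).trans hx)]; simp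

theorem abs_sub_div_sub_le_one {a b x : ℝ} (h1 : a ≤ x) (h2 : x ≤ b) :
    |(x - a) / (b - a)| ≤ 1 := by
  rw [abs_of_nonneg (div_nonneg (by linarith) (by linarith))]
  exact div_le_one_of_le₀ (by linarith) (by linarith)

theorem abs_sub_div_sub_le_one' {a b x : ℝ} (h1 : a ≤ x) (h2 : x ≤ b) :
    |(b - x) / (b - a)| ≤ 1 := by
  rw [abs_of_nonneg (div_nonneg (by linarith) (by linarith))]
  exact div_le_one_of_le₀ (by linarith) (by linarith)

/-- If `u` vanishes unless `a ≤ x ≤ b`, the weights of the Cox–de Boor recursion do not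
increase it. -/
theorem abs_weights_mul_le {a b x u : ℝ} (h1 : x < a → u = 0) (h2 : b < x → u = 0) :
    |(x - a) / (b - a) * u| ≤ |u| ∧ |(b - x) / (b - a) * u| ≤ |u| := by
  rcases lt_or_ge x a with h | h
  · simp [h1 h]
  rcases lt_or_ge b x with h' | h'
  · simp [h2 h']
  rw [abs_mul, abs_mul]
  exact ⟨mul_le_of_le_one_left (abs_nonneg u) (abs_sub_div_sub_le_one h h'),
    mul_le_of_le_one_left (abs_nonneg u) (abs_sub_div_sub_le_one' h h')⟩

/-- A crude bound: each step of the recursion adds two splines, with weights at most one. -/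
theorem abs_bspline_le (p : ℕ) {n : ℕ} (hn : 0 < n) (k i : ℕ) (x : ℝ) :
    |bspline p n k i x| ≤ 2 ^ k := by
  induction k generalizing i with
  | zero => simp only [bspline]; split_ifs <;> simp
  | succ k ih =>
    have h1 := (abs_weights_mul_le (a := knot p n i) (b := knot p n (i + (k + 1))) (x := x)
      (bspline_of_lt p hn k) (fun h => bspline_of_ge p hn k h.le)).1
    have h2 := (abs_weights_mul_le (a := knot p n (i + 1)) (b := knot p n (i + (k + 1) + 1))
      (x := x) (bspline_of_lt p hn k)
      (fun h => bspline_of_ge p hn k (by rw [add_right_comm i 1 k]; exact h.le))).2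
    rw [bspline_succ, pow_succ]
    linarith [abs_add_le
      ((x - knot p n i) / (knot p n (i + (k + 1)) - knot p n i) * bspline p n k i x)
      ((knot p n (i + (k + 1) + 1) - x) / (knot p n (i + (k + 1) + 1) - knot p n (i + 1))
          * bspline p n k (i + 1) x), ih i, ih (i + 1)]

theorem deriv_bspline_of_lt (p : ℕ) {n : ℕ} (hn : 0 < n) (k : ℕ) {i : ℕ} {x : ℝ}
    (hx : x < knot p n i) : deriv (bspline p n k i) x = 0 := by
  have h : bspline p n k i =ᶠ[𝓝 x] fun _ => 0 := by
    filter_upwards [eventually_lt_nhds hx] with y hy using bspline_of_lt p hn k hy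
  rw [h.deriv_eq, deriv_const]

theorem deriv_bspline_of_gt (p : ℕ) {n : ℕ} (hn : 0 < n) (k : ℕ) {i : ℕ} {x : ℝ}
    (hx : knot p n (i + k + 1) < x) : deriv (bspline p n k i) x = 0 := by
  have h : bspline p n k i =ᶠ[𝓝 x] fun _ => 0 := by
    filter_upwards [eventually_gt_nhds hx] with y hy using bspline_of_ge p hn k hy.le
  rw [h.deriv_eq, deriv_const]

/-- Away from the knots a B-spline is differentiable, and by the product rule applied to the
Cox–de Boor recursion its derivative is `O(n)`. -/
theorem differentiableAt_bspline_and_abs_deriv_le (p : ℕ) {n : ℕ} (hn : 0 < n) (k i : ℕ) {x : ℝ}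
    (hx : x ∉ Set.range (knot p n)) :
    DifferentiableAt ℝ (bspline p n k i) x ∧ |deriv (bspline p n k i) x| ≤ k * 2 ^ k * n := by
  induction k generalizing i with
  | zero =>
    suffices h : HasDerivAt (bspline p n 0 i) 0 x by
      exact ⟨h.differentiableAt, by simp [h.deriv]⟩
    rcases lt_or_ge x (knot p n i) with h | h
    · refine (hasDerivAt_const x (0 : ℝ)).congr_of_eventuallyEq ?_
      filter_upwards [eventually_lt_nhds h] with y hy using bspline_of_lt p hn 0 hy
    rcases lt_or_ge x (knot p n (i + 1)) with h' | h'
    · refine (hasDerivAt_const x (1 : ℝ)).congr_of_eventuallyEq ?_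
      filter_upwards [eventually_lt_nhds h', eventually_gt_nhds
        (lt_of_le_of_ne h fun e => hx ⟨_, e⟩)] with y hy hy'
      simp [bspline, hy, hy'.le]
    · refine (hasDerivAt_const x (0 : ℝ)).congr_of_eventuallyEq ?_
      filter_upwards [eventually_gt_nhds (lt_of_le_of_ne h' fun e => hx ⟨_, e⟩)] with y hy using
        bspline_of_ge p hn 0 hy.le
  | succ k ih =>
    set a := knot p n i
    set b := knot p n (i + (k + 1))
    set a' := knot p n (i + 1)
    set b' := knot p n (i + (k + 1) + 1)
    have hidx : i + 1 + k + 1 = i + (k + 1) + 1 := by ring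
    obtain ⟨hd, hb⟩ := ih i
    obtain ⟨hd', hb'⟩ := ih (i + 1)
    have h := ((((hasDerivAt_id x).sub_const a).div_const (b - a)).mul hd.hasDerivAt).add
      ((((hasDerivAt_id x).const_sub b').div_const (b' - a')).mul hd'.hasDerivAt)
    have h' : HasDerivAt (bspline p n (k + 1) i) _ x := h
    refine ⟨h'.differentiableAt, ?_⟩
    rw [h'.deriv]
    have h1 := (abs_weights_mul_le (a := a) (b := b) (x := x) (deriv_bspline_of_lt p hn k)
      (fun h => deriv_bspline_of_gt p hn k h)).1
    have h2 := (abs_weights_mul_le (a := a') (b := b') (x := x) (deriv_bspline_of_lt p hn k)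
      (fun h => deriv_bspline_of_gt p hn k (by rw [hidx]; exact h))).2
    have h3 : |1 / (b - a) * bspline p n k i x| ≤ n * 2 ^ k := by
      rw [abs_mul]
      exact mul_le_mul (inv_sub_knot_le p hn (by omega)) (abs_bspline_le p hn k i x)
        (abs_nonneg _) (Nat.cast_nonneg n)
    have h4 : |(-1) / (b' - a') * bspline p n k (i + 1) x| ≤ n * 2 ^ k := by
      rw [abs_mul, neg_div, abs_neg]
      exact mul_le_mul (inv_sub_knot_le p hn (by omega)) (abs_bspline_le p hn k (i + 1) x)
        (abs_nonneg _) (Nat.cast_nonneg n)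
    simp only [id]
    refine (abs_add_le _ _).trans ((add_le_add (abs_add_le _ _) (abs_add_le _ _)).trans
      ((add_le_add (add_le_add h3 (h1.trans hb)) (add_le_add h4 (h2.trans hb'))).trans_eq ?_))
    push_cast
    ring

/-- A B-spline whose knots are equidistant is a scaled and shifted cardinal B-spline. -/
theorem bspline_eq_cardinalBSpline (p : ℕ) {n : ℕ} (hn : 0 < n) (k : ℕ) {i : ℕ} (h1 : p + 1 ≤ i)
    (h2 : i + k ≤ n + p) (x : ℝ) :
    bspline p n k i x = cardinalBSpline k (n * x - ((i : ℝ) - (p + 1))) := by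
  have hn' : (0 : ℝ) < n := by positivity
  have hk : ∀ j, p + 1 ≤ j → j ≤ n + p + 1 → knot p n j = ((j : ℝ) - (p + 1)) / n := by
    intro j hj hj'
    rw [knot_eq_min_div p hn, min_eq_left (by omega), Nat.cast_sub hj]
    push_cast; rfl
  induction k generalizing i with
  | zero =>
    simp only [bspline, cardinalBSpline, hk i h1 (by omega), hk (i + 1) (by omega) (by omega),
      div_le_iff₀ hn', lt_div_iff₀ hn']
    push_cast
    congr 1
    rw [eq_iff_iff]
    constructor <;> rintro ⟨h3, h4⟩ <;> constructor <;> linarith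
  | succ k ih =>
    rw [bspline_succ, cardinalBSpline_succ, ih h1 (by omega), ih (i := i + 1) (by omega) (by omega),
      hk i h1 (by omega), hk (i + (k + 1)) (by omega) (by omega),
      hk (i + (k + 1) + 1) (by omega) (by omega), hk (i + 1) (by omega) (by omega)]
    have hk' : (k : ℝ) + 1 ≠ 0 := by positivity
    push_cast
    congr 1
    · congr 1
      rw [← sub_div, show (i : ℝ) + (k + 1) - (p + 1) - (i - (p + 1)) = k + 1 by ring]
      field_simp
    · congr 1
      · rw [← sub_div, show (i : ℝ) + (k + 1) + 1 - (p + 1) - (i + 1 - (p + 1)) = k + 1 by ring]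
        field_simp
        ring
      · congr 1; ring

theorem deriv_bspline_eq_cardinalBSpline (p : ℕ) {n : ℕ} (hn : 0 < n) (k : ℕ) {i : ℕ}
    (h1 : p + 1 ≤ i) (h2 : i + k ≤ n + p) (x : ℝ) :
    deriv (bspline p n k i) x =
      n * deriv (cardinalBSpline k) (n * x - ((i : ℝ) - (p + 1))) := by
  rw [funext (bspline_eq_cardinalBSpline p hn k h1 h2),
    deriv_comp_mul_left (n : ℝ) (fun y => cardinalBSpline k (y - ((i : ℝ) - (p + 1)))) x,
    deriv_comp_sub_const, smul_eq_mul]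

/-! ### The one-dimensional matrices are banded, bounded and Toeplitz in the interior -/

/-- `X` is banded with half-bandwidth `p`, its entries are bounded by `K`, and where row and
column are both at distance at least `p` from the ends, it is the Toeplitz matrix with
coefficients `c`. Only the values of `c` at `|k| ≤ p` matter. -/
structure IsInteriorToeplitz (p : ℕ) (K : ℝ) (c : ℤ → ℝ) {N : ℕ}
    (X : Matrix (Fin N) (Fin N) ℝ) : Prop where
  band : ∀ i j : Fin N, (p : ℤ) < |(i : ℤ) - j| → X i j = 0
  bound : ∀ i j : Fin N, |X i j| ≤ K
  interior : ∀ i j : Fin N, p ≤ (i : ℕ) → (i : ℕ) + p < N → p ≤ (j : ℕ) → (j : ℕ) + p < N →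
    |(i : ℤ) - j| ≤ p → X i j = c ((i : ℤ) - j)

theorem IsInteriorToeplitz.transpose {p : ℕ} {K : ℝ} {c : ℤ → ℝ} {N : ℕ}
    {X : Matrix (Fin N) (Fin N) ℝ} (h : IsInteriorToeplitz p K c X) :
    IsInteriorToeplitz p K (fun k => c (-k)) X.transpose where
  band i j hij := h.band j i (by rwa [abs_sub_comm])
  bound i j := h.bound j i
  interior i j h1 h2 h3 h4 h5 := by
    rw [Matrix.transpose_apply, h.interior j i h3 h4 h1 h2 (by rwa [abs_sub_comm]), neg_sub]

theorem abs_intervalIntegral_le_of_support {g : ℝ → ℝ} {C a b L : ℝ} (hC : 0 ≤ C)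
    (hg : ∀ᵐ x, |g x| ≤ C) (hsupp : ∀ x, x < a ∨ b < x → g x = 0) (hL0 : 0 ≤ L) (hL : b - a ≤ L) :
    |∫ x in (0 : ℝ)..1, g x| ≤ C * L := by
  rw [intervalIntegral.integral_of_le zero_le_one]
  have h1 : ∫ x in Set.Ioc (0 : ℝ) 1, g x = ∫ x in Set.Ioc (0 : ℝ) 1 ∩ Set.Icc a b, g x := by
    refine setIntegral_eq_of_subset_of_forall_sdiff_eq_zero measurableSet_Ioc
      Set.inter_subset_left fun x hx => hsupp x ?_
    by_contra! h
    exact hx.2 ⟨hx.1, h⟩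
  have hlt : volume (Set.Ioc (0 : ℝ) 1 ∩ Set.Icc a b) < ⊤ :=
    (measure_mono Set.inter_subset_right).trans_lt (by simp)
  rw [h1, ← Real.norm_eq_abs]
  refine (norm_setIntegral_le_of_norm_le_const_ae hlt (ae_restrict_of_ae hg)).trans ?_
  gcongr
  calc _ ≤ volume.real (Set.Icc a b) := measureReal_mono Set.inter_subset_right (by simp)
    _ = max (b - a) 0 := Real.volume_real_Icc
    _ ≤ L := max_le hL hL0

theorem intervalIntegral_comp_mul_eq_integral {Φ : ℝ → ℝ} {n : ℝ} (hn : 0 < n)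
    (hΦ : ∀ t, t < 0 ∨ n < t → Φ t = 0) :
    ∫ x in (0 : ℝ)..1, Φ (n * x) = n⁻¹ * ∫ t, Φ t := by
  rw [intervalIntegral.integral_comp_mul_left (fun t => Φ t) hn.ne', smul_eq_mul, mul_zero, mul_one,
    intervalIntegral.integral_of_le hn.le, ← integral_Icc_eq_integral_Ioc,
    setIntegral_eq_integral_of_forall_compl_eq_zero]
  intro t ht
  rw [Set.mem_Icc, not_and_or, not_le, not_le] at ht
  exact hΦ t ht

theorem ae_notMem_range_knot (p n : ℕ) : ∀ᵐ x : ℝ, x ∉ Set.range (knot p n) :=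
  (Set.countable_range _).ae_notMem _

theorem deriv_cardinalBSpline_of_neg (q : ℕ) {t : ℝ} (ht : t < 0) :
    deriv (cardinalBSpline q) t = 0 := by
  have h : cardinalBSpline q =ᶠ[𝓝 t] fun _ => 0 := by
    filter_upwards [eventually_lt_nhds ht] with y hy using cardinalBSpline_of_neg q hy
  rw [h.deriv_eq, deriv_const]

theorem deriv_cardinalBSpline_of_gt (q : ℕ) {t : ℝ} (ht : (q : ℝ) + 1 < t) :
    deriv (cardinalBSpline q) t = 0 := by
  have h : cardinalBSpline q =ᶠ[𝓝 t] fun _ => 0 := by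
    filter_upwards [eventually_gt_nhds ht] with y hy using cardinalBSpline_of_ge q hy.le
  rw [h.deriv_eq, deriv_const]

/-- The bilinear forms behind the mass, advection and stiffness matrices, treated at once: `u`, `v`
are B-splines or derivatives of B-splines, `Φ`, `Ψ` the corresponding cardinal functions and `s` the
power of `n` that makes the entries scale invariant. -/
theorem isInteriorToeplitz_of_bilinear {p n : ℕ} (hn : 0 < n) {u v : ℕ → ℝ → ℝ} {Φ Ψ : ℝ → ℝ}
    {Cu Cv s du dv : ℝ} {c : ℤ → ℝ} (hCu : 0 ≤ Cu) (hCv : 0 ≤ Cv) (hs : 0 < s)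
    (hdu : 0 < du) (hdv : 0 < dv) (hsd : s * (du * dv) = n)
    (hu : ∀ i, ∀ᵐ x, |u i x| ≤ Cu * du) (hv : ∀ i, ∀ᵐ x, |v i x| ≤ Cv * dv)
    (husupp : ∀ i x, x < knot p n i ∨ knot p n (i + p + 1) < x → u i x = 0)
    (hvsupp : ∀ i x, x < knot p n i ∨ knot p n (i + p + 1) < x → v i x = 0)
    (hΦ : ∀ t, t < 0 ∨ (p : ℝ) + 1 < t → Φ t = 0)
    (huΦ : ∀ i x, p + 1 ≤ i → i ≤ n → u i x = du * Φ (n * x - ((i : ℝ) - (p + 1))))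
    (hvΨ : ∀ i x, p + 1 ≤ i → i ≤ n → v i x = dv * Ψ (n * x - ((i : ℝ) - (p + 1))))
    (hc : ∀ a b : ℝ, ∀ k : ℤ, a - b = k → ∫ t, Φ (t - a) * Ψ (t - b) = c k) :
    IsInteriorToeplitz p (Cu * Cv * (p + 1)) c (Matrix.of fun i j : Fin (n + p - 2) =>
      s * ∫ x in (0 : ℝ)..1, u ((i : ℕ) + 2) x * v ((j : ℕ) + 2) x) where
  band i j hij := by
    have hae : ∀ᵐ x : ℝ, u ((i : ℕ) + 2) x * v ((j : ℕ) + 2) x = 0 := by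
      filter_upwards [ae_notMem_range_knot p n] with x hx
      -- The supports of the two splines have at most a knot in common.
      rw [lt_abs] at hij
      have hx' : ∀ m, x < knot p n m ∨ knot p n m < x := fun m =>
        lt_or_gt_of_ne fun h => hx ⟨m, h.symm⟩
      rcases hij with h | h
      · rcases hx' ((i : ℕ) + 2) with h1 | h1
        · rw [husupp _ _ (Or.inl h1), zero_mul]
        · rw [hvsupp ((j : ℕ) + 2) x (Or.inr ((knot_mono p hn (by omega)).trans_lt h1)), mul_zero]
      · rcases hx' ((j : ℕ) + 2) with h1 | h1
        · rw [hvsupp _ _ (Or.inl h1), mul_zero]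
        · rw [husupp ((i : ℕ) + 2) x (Or.inr ((knot_mono p hn (by omega)).trans_lt h1)), zero_mul]
    rw [Matrix.of_apply, intervalIntegral.integral_zero_ae (hae.mono fun x hx _ => hx), mul_zero]
  bound i j := by
    have hn' : (0 : ℝ) < n := by positivity
    have h := abs_intervalIntegral_le_of_support
      (g := fun x => u ((i : ℕ) + 2) x * v ((j : ℕ) + 2) x) (C := (Cu * du) * (Cv * dv))
      (a := knot p n ((i : ℕ) + 2)) (b := knot p n ((i : ℕ) + 2 + (p + 1)))
      (L := (p + 1 : ℕ) / n) (by positivity) ?_ ?_ (by positivity) (knot_add_le p hn _ _)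
    · rw [Matrix.of_apply, abs_mul, abs_of_pos hs]
      calc s * _ ≤ s * ((Cu * du) * (Cv * dv) * ((p + 1 : ℕ) / n)) := by gcongr
        _ = (s * (du * dv)) * (Cu * Cv * (p + 1)) / n := by push_cast; ring
        _ = _ := by rw [hsd]; field_simp
    · filter_upwards [hu ((i : ℕ) + 2), hv ((j : ℕ) + 2)] with x h1 h2
      rw [abs_mul]
      exact mul_le_mul h1 h2 (abs_nonneg _) (by positivity)
    · intro x hx
      rw [husupp _ _ hx, zero_mul]
  interior i j h1 h2 h3 h4 _ := by
    have hn' : (0 : ℝ) < n := by positivity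
    set a : ℝ := (((i : ℕ) + 2 : ℕ) : ℝ) - (p + 1)
    set b : ℝ := (((j : ℕ) + 2 : ℕ) : ℝ) - (p + 1)
    -- The shifted cardinal spline is supported in `[a, a + p + 1] ⊆ [0, n]`.
    have ha : 0 ≤ a := by
      have : (p : ℝ) ≤ (i : ℕ) := by exact_mod_cast h1
      simp only [a]; push_cast; linarith
    have ha' : a + p + 1 ≤ n := by
      have : ((i : ℕ) : ℝ) + 2 ≤ n := by norm_cast; omega
      simp only [a]; push_cast; linarith
    have hf : ∀ x, u ((i : ℕ) + 2) x * v ((j : ℕ) + 2) x =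
        (du * dv) * (fun t => Φ (t - a) * Ψ (t - b)) (n * x) := by
      intro x
      rw [huΦ _ _ (by omega) (by omega), hvΨ _ _ (by omega) (by omega)]
      ring
    simp_rw [Matrix.of_apply, hf]
    rw [intervalIntegral.integral_const_mul,
      intervalIntegral_comp_mul_eq_integral (Φ := fun t => Φ (t - a) * Ψ (t - b)) hn',
      hc a b ((i : ℤ) - j) (by simp only [a, b]; push_cast; ring), ← mul_assoc, hsd, ← mul_assoc,
      mul_inv_cancel₀ hn'.ne', one_mul]
    intro t ht
    have : Φ (t - a) = 0 := hΦ _ (ht.imp (fun h => by linarith) fun h => by linarith)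
    simp [this]

/-- A bound for the normalized entries of the mass, advection and stiffness matrices. -/
def entryBound (p : ℕ) : ℝ := p * 2 ^ p * (p * 2 ^ p) * (p + 1)

/-- The Toeplitz coefficient at `k = i - j` is the inner product of cardinal B-splines shifted by
`i` and `j`. -/
theorem isInteriorToeplitz_mass {p n : ℕ} (hp : 1 ≤ p) (hn : 0 < n) :
    IsInteriorToeplitz p (entryBound p)
      (fun k => cardinalBSpline (2 * p + 1) ((p : ℝ) + 1 - k)) ((n : ℝ) • massMatrix p n) := by
  have hp' : (1 : ℝ) ≤ p := by exact_mod_cast hp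
  have hb : ∀ i x, |bspline p n p i x| ≤ p * 2 ^ p * 1 := fun i x => by
    refine (abs_bspline_le p hn p i x).trans ?_
    rw [mul_one]
    exact le_mul_of_one_le_left (by positivity) hp'
  refine isInteriorToeplitz_of_bilinear (u := bspline p n p) (v := bspline p n p)
    (Φ := cardinalBSpline p) (Ψ := cardinalBSpline p) hn (by positivity) (by positivity)
    (by positivity) one_pos one_pos (by ring) (fun i => Eventually.of_forall (hb i))
    (fun i => Eventually.of_forall (hb i)) ?_ ?_ ?_ ?_ ?_ ?_
  · exact fun i x h => h.elim (bspline_of_lt p hn p) fun h => bspline_of_ge p hn p h.le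
  · exact fun i x h => h.elim (bspline_of_lt p hn p) fun h => bspline_of_ge p hn p h.le
  · exact fun t h => h.elim (cardinalBSpline_of_neg p) fun h => cardinalBSpline_of_ge p h.le
  · intro i x h1 h2
    rw [one_mul, bspline_eq_cardinalBSpline p hn p h1 (by omega)]
  · intro i x h1 h2
    rw [one_mul, bspline_eq_cardinalBSpline p hn p h1 (by omega)]
  · intro a b k h
    rw [integral_cardinalBSpline_mass, h]

theorem ae_abs_deriv_bspline_le (p : ℕ) {n : ℕ} (hn : 0 < n) (i : ℕ) :
    ∀ᵐ x, |deriv (bspline p n p i) x| ≤ p * 2 ^ p * n :=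
  (ae_notMem_range_knot p n).mono fun _ hx =>
    (differentiableAt_bspline_and_abs_deriv_le p hn p i hx).2

theorem isInteriorToeplitz_advection {p n : ℕ} (hp : 1 ≤ p) (hn : 0 < n) :
    IsInteriorToeplitz p (entryBound p)
      (fun k => -deriv (cardinalBSpline (2 * p + 1)) ((p : ℝ) + 1 - k)) (advectionMatrix p n) := by
  have hp' : (1 : ℝ) ≤ p := by exact_mod_cast hp
  have hb : ∀ i x, |bspline p n p i x| ≤ p * 2 ^ p * 1 := fun i x => by
    refine (abs_bspline_le p hn p i x).trans ?_
    rw [mul_one]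
    exact le_mul_of_one_le_left (by positivity) hp'
  rw [← one_smul ℝ (advectionMatrix p n)]
  refine isInteriorToeplitz_of_bilinear (u := bspline p n p) (v := fun i => deriv (bspline p n p i))
    (Φ := cardinalBSpline p) (Ψ := deriv (cardinalBSpline p)) (dv := n) hn (by positivity)
    (by positivity) one_pos one_pos (by positivity) (by ring) (fun i => Eventually.of_forall (hb i))
    (ae_abs_deriv_bspline_le p hn) ?_ ?_ ?_ ?_ ?_ ?_
  · exact fun i x h => h.elim (bspline_of_lt p hn p) fun h => bspline_of_ge p hn p h.le
  · exact fun i x h => h.elim (deriv_bspline_of_lt p hn p) (deriv_bspline_of_gt p hn p)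
  · exact fun t h => h.elim (cardinalBSpline_of_neg p) fun h => cardinalBSpline_of_ge p h.le
  · intro i x h1 h2
    rw [one_mul, bspline_eq_cardinalBSpline p hn p h1 (by omega)]
  · intro i x h1 h2
    rw [deriv_bspline_eq_cardinalBSpline p hn p h1 (by omega)]
  · intro a b k h
    rw [integral_cardinalBSpline_advection hp, h]

theorem isInteriorToeplitz_stiffness {p n : ℕ} (hp : 1 ≤ p) (hn : 0 < n) :
    IsInteriorToeplitz p (entryBound p)
      (fun k => -iteratedDeriv 2 (cardinalBSpline (2 * p + 1)) ((p : ℝ) + 1 - k))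
      ((n : ℝ)⁻¹ • stiffnessMatrix p n) := by
  have hn' : (n : ℝ) ≠ 0 := by positivity
  refine isInteriorToeplitz_of_bilinear (u := fun i => deriv (bspline p n p i))
    (v := fun i => deriv (bspline p n p i)) (Φ := deriv (cardinalBSpline p))
    (Ψ := deriv (cardinalBSpline p)) (du := n) (dv := n) hn (by positivity)
    (by positivity) (by positivity) (by positivity) (by positivity) (by field_simp)
    (ae_abs_deriv_bspline_le p hn) (ae_abs_deriv_bspline_le p hn) ?_ ?_ ?_ ?_ ?_ ?_
  · exact fun i x h => h.elim (deriv_bspline_of_lt p hn p) (deriv_bspline_of_gt p hn p)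
  · exact fun i x h => h.elim (deriv_bspline_of_lt p hn p) (deriv_bspline_of_gt p hn p)
  · exact fun t h => h.elim (deriv_cardinalBSpline_of_neg p) (deriv_cardinalBSpline_of_gt p)
  · intro i x h1 h2
    rw [deriv_bspline_eq_cardinalBSpline p hn p h1 (by omega)]
  · intro i x h1 h2
    rw [deriv_bspline_eq_cardinalBSpline p hn p h1 (by omega)]
  · intro a b k h
    rw [integral_cardinalBSpline_stiffness hp, h]

/-! ### The method of moments for Hermitian matrices -/

section Eigenvalues

variable {ι : Type*} [Fintype ι] [DecidableEq ι] {A : Matrix ι ι ℂ}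

theorem eigenvalueSum_eq_sum_eigenvalues (hA : A.IsHermitian) (F : ℂ → ℂ) :
    eigenvalueSum F A = ∑ i, F (hA.eigenvalues i) := by
  rw [eigenvalueSum, hA.roots_charpoly_eq_eigenvalues, Multiset.map_map]
  rfl

theorem trace_pow_eq_sum_eigenvalues_pow (hA : A.IsHermitian) (m : ℕ) :
    (A ^ m).trace = ∑ i, (hA.eigenvalues i : ℂ) ^ m := by
  conv_lhs => rw [hA.spectral_theorem]
  rw [← map_pow, Unitary.conjStarAlgAut_apply, Matrix.trace_mul_cycle,
    Unitary.coe_star_mul_self, one_mul, Matrix.diagonal_pow, Matrix.trace_diagonal]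
  rfl

theorem eigenvalueSum_polynomial (hA : A.IsHermitian) (Q : Polynomial ℂ) :
    eigenvalueSum (fun z => Q.eval z) A =
      ∑ m ∈ Finset.range (Q.natDegree + 1), Q.coeff m * (A ^ m).trace := by
  simp_rw [eigenvalueSum_eq_sum_eigenvalues hA, trace_pow_eq_sum_eigenvalues_pow hA,
    Polynomial.eval_eq_sum_range, Finset.mul_sum]
  exact Finset.sum_comm

/-- A consequence of Gershgorin's theorem. -/
theorem abs_eigenvalues_le_of_rowSum_le (hA : A.IsHermitian) {R : ℝ}
    (hR : ∀ i, ∑ j, ‖A i j‖ ≤ R) (i : ι) : |hA.eigenvalues i| ≤ R := by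
  have h1 : (hA.eigenvalues i : ℂ) ∈ spectrum ℂ A := by
    rw [hA.spectrum_eq_image_range]
    exact ⟨_, ⟨i, rfl⟩, rfl⟩
  rw [← Matrix.spectrum_toLin', ← Module.End.hasEigenvalue_iff_mem_spectrum] at h1
  obtain ⟨k, hk⟩ := eigenvalue_mem_ball h1
  rw [mem_closedBall_iff_norm] at hk
  have h2 : ‖(hA.eigenvalues i : ℂ)‖ ≤ ∑ j, ‖A k j‖ := by
    rw [← Finset.add_sum_erase _ _ (Finset.mem_univ k)]
    have := norm_sub_norm_le (hA.eigenvalues i : ℂ) (A k k)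
    linarith
  rw [Complex.norm_real, Real.norm_eq_abs] at h2
  exact h2.trans (hR k)

theorem norm_eigenvalueSum_sub_le (hA : A.IsHermitian) {R ε : ℝ}
    (hR : ∀ i, ∑ j, ‖A i j‖ ≤ R) {F Q : ℂ → ℂ}
    (h : ∀ x ∈ Set.Icc (-R) R, ‖F (x : ℝ) - Q (x : ℝ)‖ ≤ ε) :
    ‖eigenvalueSum F A - eigenvalueSum Q A‖ ≤ Fintype.card ι * ε := by
  rw [eigenvalueSum_eq_sum_eigenvalues hA, eigenvalueSum_eq_sum_eigenvalues hA,
    ← Finset.sum_sub_distrib]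
  refine (norm_sum_le _ _).trans ((Finset.sum_le_card_nsmul _ _ ε fun i _ => h _ ?_).trans_eq ?_)
  · exact abs_le.1 (abs_eigenvalues_le_of_rowSum_le hA hR i)
  · simp

/-- The statement includes the empty index type, where both quotients are zero. -/
theorem norm_div_card_sub_le {ι : Type*} [Fintype ι] {x y : ℂ} {ε : ℝ} (hε : 0 ≤ ε)
    (h : ‖x - y‖ ≤ Fintype.card ι * ε) :
    ‖x / (Fintype.card ι : ℂ) - y / (Fintype.card ι : ℂ)‖ ≤ ε := by
  rw [← sub_div, norm_div, Complex.norm_natCast]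
  exact div_le_of_le_mul₀ (by positivity) hε (by rwa [mul_comm])

end Eigenvalues

/-- Weierstrass approximation for complex-valued functions on a real interval. -/
theorem exists_complex_polynomial_near {F : ℂ → ℂ} (hF : Continuous F) (R : ℝ) {ε : ℝ}
    (hε : 0 < ε) :
    ∃ Q : Polynomial ℂ, ∀ x ∈ Set.Icc (-R) R, ‖F (x : ℝ) - Q.eval ((x : ℝ) : ℂ)‖ ≤ ε := by
  obtain ⟨P₁, h₁⟩ := exists_polynomial_near_of_continuousOn (-R) R (fun x => (F x).re)
    (by fun_prop) (ε / 2) (by positivity)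
  obtain ⟨P₂, h₂⟩ := exists_polynomial_near_of_continuousOn (-R) R (fun x => (F x).im)
    (by fun_prop) (ε / 2) (by positivity)
  refine ⟨P₁.map Complex.ofRealHom + Polynomial.C Complex.I * P₂.map Complex.ofRealHom,
    fun x hx => ?_⟩
  have e : ∀ P : Polynomial ℝ, (P.map Complex.ofRealHom).eval (x : ℂ) = ((P.eval x : ℝ) : ℂ) := by
    intro P
    rw [Polynomial.eval_map, ← Complex.ofRealHom_eq_coe, Polynomial.eval₂_at_apply]
    rfl
  rw [Polynomial.eval_add, Polynomial.eval_mul, Polynomial.eval_C, e, e, norm_sub_rev]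
  refine (Complex.norm_le_abs_re_add_abs_im _).trans ?_
  have h1 := h₁ x hx
  have h2 := h₂ x hx
  simp at h1 h2 ⊢
  linarith

/-- Hermitian matrices with uniformly bounded row sums whose normalized trace moments converge to
those of a continuous Hermitian symbol are distributed like the symbol: all eigenvalues lie in a
fixed compact interval, on which continuous functions are uniform limits of polynomials. -/
theorem eigenvalueDistributed_of_tendsto_trace_pow {κ : Type*} {l : Filter κ} {ι : κ → Type*}
    [∀ k, Fintype (ι k)] [∀ k, DecidableEq (ι k)] {A : ∀ k, Matrix (ι k) (ι k) ℂ}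
    {q s : ℕ} {f : (Fin q → ℝ) → Matrix (Fin s) (Fin s) ℂ} {G : Set (Fin q → ℝ)}
    (hG : IsCompact G) (hG0 : 0 < volume G) (hf : Continuous f)
    (hfH : ∀ t ∈ G, (f t).IsHermitian) (hA : ∀ k, (A k).IsHermitian) {R₁ : ℝ}
    (hR₁ : ∀ k i, ∑ j, ‖A k i j‖ ≤ R₁) (hcard : Tendsto (fun k => Fintype.card (ι k)) l atTop)
    (hmom : ∀ m : ℕ, Tendsto (fun k => 1 / (Fintype.card (ι k) : ℂ) * (A k ^ m).trace) l
      (𝓝 (1 / (volume.real G : ℂ) * ∫ t in G, (f t ^ m).trace / (s : ℂ)))) :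
    EigenvalueDistributed l A f G := by
  have hfij : ∀ i j, Continuous fun t => f t i j := fun i j => hf.matrix_elem i j
  obtain ⟨R₂, hR₂⟩ : ∃ R₂, ∀ t ∈ G, ∀ i, ∑ j, ‖f t i j‖ ≤ R₂ := by
    obtain ⟨R₂, h⟩ := hG.bddAbove_image (f := fun t => ∑ i, ∑ j, ‖f t i j‖)
      (by fun_prop)
    refine ⟨R₂, fun t ht i => le_trans ?_ (h ⟨t, ht, rfl⟩)⟩
    exact Finset.single_le_sum (f := fun i => ∑ j, ‖f t i j‖)
      (fun i _ => Finset.sum_nonneg fun j _ => norm_nonneg _) (Finset.mem_univ i)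
  set R := max R₁ R₂
  have hRA : ∀ k i, ∑ j, ‖A k i j‖ ≤ R := fun k i => (hR₁ k i).trans (le_max_left _ _)
  have hRf : ∀ t ∈ G, ∀ i, ∑ j, ‖f t i j‖ ≤ R := fun t ht i =>
    (hR₂ t ht i).trans (le_max_right _ _)
  have hpow : ∀ m, Continuous fun t => (f t ^ m).trace := fun m => (hf.pow m).matrix_trace
  have hQcont : ∀ Q : Polynomial ℂ,
      ContinuousOn (fun t => eigenvalueSum (fun z => Q.eval z) (f t) / (s : ℂ)) G := by
    intro Q
    refine ContinuousOn.congr (f := fun t => (∑ m ∈ Finset.range (Q.natDegree + 1),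
      Q.coeff m * (f t ^ m).trace) / (s : ℂ)) ?_ fun t ht => by
        simp only [eigenvalueSum_polynomial (hfH t ht)]
    exact Continuous.continuousOn ((continuous_finsetSum _ fun m _ =>
      continuous_const.mul (hpow m)).div_const _)
  have happ : ∀ {F Q : ℂ → ℂ} {ε : ℝ}, 0 ≤ ε →
      (∀ x ∈ Set.Icc (-R) R, ‖F (x : ℝ) - Q (x : ℝ)‖ ≤ ε) → ∀ t ∈ G,
      ‖eigenvalueSum F (f t) / (s : ℂ) - eigenvalueSum Q (f t) / (s : ℂ)‖ ≤ ε := by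
    intro F Q ε hε h t ht
    simpa using norm_div_card_sub_le (ι := Fin s) hε
      (norm_eigenvalueSum_sub_le (hfH t ht) (hRf t ht) h)
  have hFcont : ∀ F : ℂ → ℂ, Continuous F →
      ContinuousOn (fun t => eigenvalueSum F (f t) / (s : ℂ)) G := by
    intro F hF
    refine continuousOn_of_uniform_approx_of_continuousOn fun u hu => ?_
    obtain ⟨ε, hε, hu⟩ := Metric.mem_uniformity_dist.1 hu
    obtain ⟨Q, hQ⟩ := exists_complex_polynomial_near hF R (half_pos hε)
    refine ⟨_, hQcont Q, fun t ht => hu ?_⟩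
    rw [dist_eq_norm]
    exact (happ (half_pos hε).le hQ t ht).trans_lt (half_lt_self hε)
  have hGr : 0 < volume.real G := ENNReal.toReal_pos hG0.ne' hG.measure_lt_top.ne
  have hQlim : ∀ Q : Polynomial ℂ, Tendsto
      (fun k => 1 / (Fintype.card (ι k) : ℂ) * eigenvalueSum (fun z => Q.eval z) (A k)) l
      (𝓝 (1 / (volume.real G : ℂ) *
        ∫ t in G, eigenvalueSum (fun z => Q.eval z) (f t) / (s : ℂ))) := by
    intro Q
    have h := tendsto_finsetSum (Finset.range (Q.natDegree + 1))
      fun m _ => (hmom m).const_mul (Q.coeff m)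
    convert h using 1
    · funext k
      rw [eigenvalueSum_polynomial (hA k), Finset.mul_sum]
      exact Finset.sum_congr rfl fun m _ => by ring
    · congr 1
      rw [setIntegral_congr_fun hG.measurableSet (g := fun t =>
        ∑ m ∈ Finset.range (Q.natDegree + 1), Q.coeff m * ((f t ^ m).trace / (s : ℂ)))]
      · rw [integral_finsetSum]
        · rw [Finset.mul_sum]
          refine Finset.sum_congr rfl fun m _ => ?_
          rw [integral_const_mul]
          ring
        · intro m _
          exact ((hpow m).div_const _ |>.const_mul _).continuousOn.integrableOn_compact hG
      · intro t ht
        simp only [eigenvalueSum_polynomial (hfH t ht), Finset.sum_div]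
        exact Finset.sum_congr rfl fun m _ => by ring
  refine ⟨hG.measurableSet, hG0, hG.measure_lt_top,
    fun i j => (hfij i j).measurable.comp measurable_subtype_coe, hcard, fun F hF _ => ?_⟩
  refine ⟨(hFcont F hF).integrableOn_compact hG, ?_⟩
  rw [Metric.tendsto_nhds]
  intro ε hε
  obtain ⟨Q, hQ⟩ := exists_complex_polynomial_near hF R (by positivity : 0 < ε / 3)
  filter_upwards [Metric.tendsto_nhds.1 (hQlim Q) (ε / 3) (by positivity)] with k hk
  have h1 : ‖1 / (Fintype.card (ι k) : ℂ) * eigenvalueSum F (A k) -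
      1 / (Fintype.card (ι k) : ℂ) * eigenvalueSum (fun z => Q.eval z) (A k)‖ ≤ ε / 3 := by
    rw [one_div_mul_eq_div, one_div_mul_eq_div]
    exact norm_div_card_sub_le (by positivity) (norm_eigenvalueSum_sub_le (hA k) (hRA k) hQ)
  have h2 : ‖1 / (volume.real G : ℂ) *
        (∫ t in G, eigenvalueSum (fun z => Q.eval z) (f t) / (s : ℂ)) -
      1 / (volume.real G : ℂ) * ∫ t in G, eigenvalueSum F (f t) / (s : ℂ)‖ ≤ ε / 3 := by
    rw [← mul_sub, ← integral_sub ((hQcont Q).integrableOn_compact hG)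
      ((hFcont F hF).integrableOn_compact hG), norm_mul, norm_div, norm_one, Complex.norm_real,
      Real.norm_of_nonneg hGr.le, one_div_mul_eq_div, div_le_iff₀ hGr]
    refine norm_setIntegral_le_of_norm_le_const hG.measure_lt_top fun t ht => ?_
    rw [norm_sub_rev]
    exact happ (by positivity) hQ t ht
  rw [← dist_eq_norm] at h1 h2
  calc _ ≤ _ := dist_triangle4 _ _ _ _
    _ < ε / 3 + ε / 3 + ε / 3 := add_lt_add_of_lt_of_le (add_lt_add_of_le_of_lt h1 hk) h2
    _ = ε := by ring

/-! ### Fourier analysis on the box -/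

/-- The cube `[-π, π]^q`. -/
def fourierCube (q : ℕ) : Set (Fin q → ℝ) := Set.Icc (fun _ => -π) (fun _ => π)

/-- The character `θ ↦ exp (i k·θ)`. -/
noncomputable def torusChar {q : ℕ} (k : Fin q → ℤ) (θ : Fin q → ℝ) : ℂ :=
  ∏ l, Complex.exp (Complex.I * k l * θ l)

theorem torusChar_add {q : ℕ} (k k' : Fin q → ℤ) (θ : Fin q → ℝ) :
    torusChar (k + k') θ = torusChar k θ * torusChar k' θ := by
  simp only [torusChar, ← Finset.prod_mul_distrib, ← Complex.exp_add, Pi.add_apply]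
  refine Finset.prod_congr rfl fun l _ => ?_
  congr 1
  push_cast
  ring

theorem continuous_torusChar {q : ℕ} (k : Fin q → ℤ) : Continuous (torusChar k) := by
  unfold torusChar
  fun_prop

theorem volume_fourierCube (q : ℕ) : volume.real (fourierCube q) = (2 * π) ^ q := by
  rw [fourierCube, Measure.real, Real.volume_Icc_pi, ENNReal.toReal_prod]
  simp only [Finset.prod_const, Finset.card_univ, Fintype.card_fin]
  rw [ENNReal.toReal_ofReal (by linarith [pi_pos])]
  ring

theorem setIntegral_exp_int_mul (k : ℤ) :
    ∫ t in Set.Icc (-π) π, Complex.exp (Complex.I * k * (t : ℝ)) =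
      if k = 0 then (2 * π : ℂ) else 0 := by
  have hπ : -π ≤ π := by linarith [pi_pos]
  rw [integral_Icc_eq_integral_Ioc, ← intervalIntegral.integral_of_le hπ]
  split_ifs with h
  · simp [h, two_mul]
  · have hk : Complex.I * (k : ℂ) ≠ 0 := by simp [h]
    rw [integral_exp_mul_complex hk, div_eq_zero_iff]
    left
    rw [sub_eq_zero, Complex.exp_eq_exp_iff_exists_int]
    exact ⟨k, by push_cast; ring⟩

/-- Orthogonality of the characters. -/
theorem setIntegral_torusChar {q : ℕ} (k : Fin q → ℤ) :
    ∫ θ in fourierCube q, torusChar k θ = if k = 0 then (2 * π : ℂ) ^ q else 0 := by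
  have h : (volume : Measure (Fin q → ℝ)).restrict (fourierCube q) =
      Measure.pi fun _ => volume.restrict (Set.Icc (-π) π) := by
    rw [← Measure.restrict_pi_pi, fourierCube, Set.pi_univ_Icc]
    rfl
  rw [h]
  unfold torusChar
  rw [integral_fintype_prod_eq_prod (fun l (t : ℝ) => Complex.exp (Complex.I * k l * t))]
  simp_rw [setIntegral_exp_int_mul]
  split_ifs with hk
  · simp [hk]
  · obtain ⟨l, hl⟩ := Function.ne_iff.1 hk
    exact Finset.prod_eq_zero (Finset.mem_univ l) (if_neg hl)

/-- The multi-indices all of whose components are at most `p` in absolute value. -/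
noncomputable def frequencyBox (q p : ℕ) : Finset (Fin q → ℤ) :=
  Fintype.piFinset fun _ => Finset.Icc (-(p : ℤ)) p

theorem mem_frequencyBox {q p : ℕ} {k : Fin q → ℤ} :
    k ∈ frequencyBox q p ↔ ∀ l, |k l| ≤ p := by
  simp [frequencyBox, abs_le]

/-- The matrix-valued trigonometric polynomial with coefficients `C k`, `|k l| ≤ p`. -/
noncomputable def trigPoly {q s : ℕ} (p : ℕ) (C : (Fin q → ℤ) → Matrix (Fin s) (Fin s) ℂ)
    (θ : Fin q → ℝ) : Matrix (Fin s) (Fin s) ℂ :=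
  ∑ k ∈ frequencyBox q p, torusChar k θ • C k

theorem continuous_trigPoly {q s : ℕ} (p : ℕ) (C : (Fin q → ℤ) → Matrix (Fin s) (Fin s) ℂ) :
    Continuous (trigPoly p C) :=
  continuous_finsetSum _ fun k _ => (continuous_torusChar k).smul continuous_const

/-! ### Multilevel matrices that are Toeplitz in the interior -/

section Multilevel

variable {q : ℕ} {ι : Type*} {N : Fin q → ℕ}

/-- The integer coordinates of an index of a multilevel matrix. -/
def gridPos (e : ι ≃ ∀ l, Fin (N l)) (i : ι) : Fin q → ℤ := fun l => ((e i l : ℕ) : ℤ)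

/-- The index `i` has distance at least `r` from the boundary of the grid. -/
def IsDeep (e : ι ≃ ∀ l, Fin (N l)) (r : ℕ) (i : ι) : Prop :=
  ∀ l, (r : ℤ) ≤ gridPos e i l ∧ gridPos e i l + r < N l

theorem gridPos_injective (e : ι ≃ ∀ l, Fin (N l)) : Function.Injective (gridPos e) := by
  intro i j h
  apply e.injective
  funext l
  have := congrFun h l
  simp only [gridPos] at this
  exact Fin.ext (by exact_mod_cast this)

theorem exists_gridPos_eq (e : ι ≃ ∀ l, Fin (N l)) {v : Fin q → ℤ}
    (hv : ∀ l, 0 ≤ v l ∧ v l < N l) : ∃ i, gridPos e i = v := by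
  refine ⟨e.symm fun l => ⟨(v l).toNat, by have := hv l; omega⟩, ?_⟩
  funext l
  simp [gridPos, (hv l).1]

theorem card_isDeep [Fintype ι] (e : ι ≃ ∀ l, Fin (N l)) (r : ℕ) [DecidablePred (IsDeep e r)] :
    (Finset.univ.filter (IsDeep e r)).card = ∏ l, (N l - 2 * r) := by
  have : (Finset.univ.filter (IsDeep e r)).card =
      (Fintype.piFinset fun l => Finset.Ico (r : ℤ) (N l - r)).card := by
    refine Finset.card_nbij (gridPos e) ?_ (gridPos_injective e).injOn ?_
    · intro i hi
      simp only [Finset.coe_filter, Finset.mem_univ, true_and, Set.mem_ofPred_eq] at hi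
      simp only [Finset.mem_coe, Fintype.mem_piFinset, Finset.mem_Ico]
      exact fun l => ⟨(hi l).1, by linarith [(hi l).2]⟩
    · intro v hv
      simp only [Finset.mem_coe, Fintype.mem_piFinset, Finset.mem_Ico] at hv
      obtain ⟨i, hi⟩ := exists_gridPos_eq e (v := v)
        fun l => ⟨by have := hv l; omega, by have := hv l; omega⟩
      refine ⟨i, ?_, hi⟩
      simp only [Finset.coe_filter, Finset.mem_univ, true_and, Set.mem_ofPred_eq, IsDeep, hi]
      exact fun l => ⟨(hv l).1, by linarith [(hv l).2]⟩
  rw [this, Fintype.card_piFinset]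
  refine Finset.prod_congr rfl fun l _ => ?_
  rw [Int.card_Ico]
  omega

variable [Fintype ι] [DecidableEq ι] {s p r : ℕ} {C : (Fin q → ℤ) → Matrix (Fin s) (Fin s) ℂ}
  {B : Matrix (Fin s × ι) (Fin s × ι) ℂ}

/-- Sufficiently far from the boundary, the entries of `B ^ m` are the Fourier coefficients of the
`m`-th power of the symbol. -/
theorem pow_apply_eq_fourier_of_isDeep (e : ι ≃ ∀ l, Fin (N l))
    (hB : ∀ i j a b, IsDeep e r i → B (a, i) (b, j) =
      if gridPos e i - gridPos e j ∈ frequencyBox q p then C (gridPos e i - gridPos e j) a b else 0)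
    (m : ℕ) {i : ι} (hi : IsDeep e (r + m * p) i) (j : ι) (a b : Fin s) :
    (B ^ m) (a, i) (b, j) = ((2 * π : ℂ) ^ q)⁻¹ * ∫ θ in fourierCube q,
      (trigPoly p C θ ^ m) a b * torusChar (gridPos e j - gridPos e i) θ := by
  induction m generalizing i a with
  | zero =>
    have hπ : (2 * π : ℂ) ≠ 0 := by exact_mod_cast two_pi_pos.ne'
    simp only [pow_zero, integral_const_mul, setIntegral_torusChar, sub_eq_zero,
      (gridPos_injective e).eq_iff, Matrix.one_apply, Prod.mk.injEq, eq_comm (a := j) (b := i)]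
    by_cases h1 : a = b <;> by_cases h2 : i = j <;> simp [h1, h2, hπ]
  | succ m ih =>
    have hi0 : IsDeep e r i := fun l => by
      have := hi l
      push_cast at this
      constructor <;> nlinarith [this.1, this.2, (by positivity : (0 : ℤ) ≤ (m + 1) * p)]
    have hcont : ∀ (c : Fin s) (k : Fin q → ℤ), Continuous fun θ =>
        (trigPoly p C θ ^ m) c b * torusChar k θ := fun c k =>
      (((continuous_trigPoly p C).pow m).matrix_elem c b).mul (continuous_torusChar k)
    have hG : IsCompact (fourierCube q) := isCompact_Icc
    have hf : ∀ θ, (trigPoly p C θ ^ (m + 1)) a b * torusChar (gridPos e j - gridPos e i) θ =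
        ∑ c, ∑ k ∈ frequencyBox q p, C k a c * ((trigPoly p C θ ^ m) c b *
          torusChar (k + (gridPos e j - gridPos e i)) θ) := by
      intro θ
      rw [pow_succ', Matrix.mul_apply, Finset.sum_mul]
      refine Finset.sum_congr rfl fun c _ => ?_
      rw [show trigPoly p C θ a c = ∑ k ∈ frequencyBox q p, torusChar k θ * C k a c by
        simp [trigPoly, Matrix.sum_apply], Finset.sum_mul, Finset.sum_mul]
      refine Finset.sum_congr rfl fun k _ => ?_
      rw [torusChar_add]
      ring
    simp_rw [hf]
    rw [integral_finsetSum _ fun c _ => integrable_finsetSum _ fun k _ =>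
      ((hcont c _).const_mul _).continuousOn.integrableOn_compact hG, pow_succ', Matrix.mul_apply,
      Fintype.sum_prod_type, Finset.mul_sum]
    refine Finset.sum_congr rfl fun c _ => ?_
    rw [integral_finsetSum _ fun k _ =>
      ((hcont c _).const_mul _).continuousOn.integrableOn_compact hG]
    simp_rw [hB i _ a c hi0, ite_mul, zero_mul]
    rw [← Finset.sum_filter, Finset.mul_sum]
    -- As `i` is deep, every frequency `k` in the box is `gridPos e i - gridPos e j'` for some `j'`,
    -- and `j'` is still deep enough for the induction hypothesis.
    refine Finset.sum_nbij (fun j' => gridPos e i - gridPos e j') ?_ ?_ ?_ ?_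
    · intro j' hj'
      exact (Finset.mem_filter.1 hj').2
    · exact fun j' _ j'' _ h => gridPos_injective e (sub_right_injective h)
    · intro k hk
      have hk' := mem_frequencyBox.1 hk
      obtain ⟨j', hj'⟩ := exists_gridPos_eq e (v := gridPos e i - k) fun l => by
        have h1 := hi l
        have h2 := abs_le.1 (hk' l)
        push_cast at h1
        simp only [Pi.sub_apply]
        constructor <;> nlinarith [h1.1, h1.2, h2.1, h2.2, (by positivity : (0 : ℤ) ≤ m * p)]
      refine ⟨j', ?_, by simp [hj']⟩
      simpa [hj'] using hk
    · intro j' hj'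
      have hk := mem_frequencyBox.1 (Finset.mem_filter.1 hj').2
      rw [ih (i := j') (fun l => ?_) c, integral_const_mul,
        show gridPos e i - gridPos e j' + (gridPos e j - gridPos e i) =
          gridPos e j - gridPos e j' by abel]
      · ring
      · have h1 := hi l
        have h2 := abs_le.1 (hk l)
        push_cast at h1 ⊢
        simp only [Pi.sub_apply] at h2
        constructor <;> nlinarith [h1.1, h1.2, h2.1, h2.2]

theorem rowSum_pow_le {n : Type*} [Fintype n] [DecidableEq n] {B : Matrix n n ℂ} {R : ℝ}
    (hR : ∀ i, ∑ j, ‖B i j‖ ≤ R) (m : ℕ) (i : n) : ∑ j, ‖(B ^ m) i j‖ ≤ R ^ m := by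
  have hR0 : 0 ≤ R := (Finset.sum_nonneg fun j _ => norm_nonneg _).trans (hR i)
  induction m generalizing i with
  | zero => simp [Matrix.one_apply, apply_ite norm]
  | succ m ih =>
    calc ∑ j, ‖(B ^ (m + 1)) i j‖ ≤ ∑ j, ∑ k, ‖B i k‖ * ‖(B ^ m) k j‖ := by
          refine Finset.sum_le_sum fun j _ => ?_
          rw [pow_succ', Matrix.mul_apply]
          exact (norm_sum_le _ _).trans_eq (by simp)
      _ = ∑ k, ‖B i k‖ * ∑ j, ‖(B ^ m) k j‖ := by
          rw [Finset.sum_comm]; simp [Finset.mul_sum]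
      _ ≤ ∑ k, ‖B i k‖ * R ^ m := by
          gcongr with k _
          exact ih k
      _ ≤ R ^ (m + 1) := by
          rw [← Finset.sum_mul, pow_succ']
          gcongr
          exact hR i

/-- The trace of `B ^ m` differs from the one predicted by the symbol only by the contribution of
the indices near the boundary. -/
theorem norm_trace_pow_sub_le (e : ι ≃ ∀ l, Fin (N l))
    (hB : ∀ i j a b, IsDeep e r i → B (a, i) (b, j) =
      if gridPos e i - gridPos e j ∈ frequencyBox q p then C (gridPos e i - gridPos e j) a b else 0)
    {R : ℝ} (hR : ∀ x, ∑ y, ‖B x y‖ ≤ R) (m : ℕ) :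
    ‖(B ^ m).trace - Fintype.card ι *
        (((2 * π : ℂ) ^ q)⁻¹ * ∫ θ in fourierCube q, (trigPoly p C θ ^ m).trace)‖ ≤
      ((∏ l, (N l : ℝ)) - ∏ l, ((N l - 2 * (r + m * p) : ℕ) : ℝ)) *
        (s * R ^ m + ‖((2 * π : ℂ) ^ q)⁻¹ *
          ∫ θ in fourierCube q, (trigPoly p C θ ^ m).trace‖) := by
  classical
  set c := ((2 * π : ℂ) ^ q)⁻¹ * ∫ θ in fourierCube q, (trigPoly p C θ ^ m).trace with hc
  have hG : IsCompact (fourierCube q) := isCompact_Icc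
  have hdeep : ∀ i, IsDeep e (r + m * p) i → ∑ a, (B ^ m) (a, i) (a, i) = c := by
    intro i hi
    simp_rw [pow_apply_eq_fourier_of_isDeep e hB m hi]
    rw [← Finset.mul_sum, hc, ← integral_finsetSum]
    · congr 1
      refine integral_congr_ae (Eventually.of_forall fun θ => ?_)
      simp [torusChar, Matrix.trace]
    · intro a _
      exact ((((continuous_trigPoly p C).pow m).matrix_elem a a).mul
        (continuous_torusChar _)).continuousOn.integrableOn_compact hG
  have htr : (B ^ m).trace - Fintype.card ι * c = ∑ i, ((∑ a, (B ^ m) (a, i) (a, i)) - c) := by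
    rw [Finset.sum_sub_distrib, Finset.sum_const, nsmul_eq_mul, Finset.card_univ, Matrix.trace,
      Fintype.sum_prod_type, Finset.sum_comm]
    rfl
  have hcard : (((Finset.univ.filter fun i => ¬ IsDeep e (r + m * p) i).card : ℕ) : ℝ) =
      (∏ l, (N l : ℝ)) - ∏ l, ((N l - 2 * (r + m * p) : ℕ) : ℝ) := by
    have h1 := Finset.card_filter_add_card_filter_not (s := (Finset.univ : Finset ι))
      (IsDeep e (r + m * p))
    rw [card_isDeep, Finset.card_univ, Fintype.card_congr e, Fintype.card_pi] at h1
    simp only [Fintype.card_fin] at h1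
    rw [eq_sub_iff_add_eq']
    exact_mod_cast h1
  rw [htr, ← Finset.sum_filter_add_sum_filter_not _ (IsDeep e (r + m * p)),
    Finset.sum_eq_zero (s := Finset.univ.filter (IsDeep e (r + m * p))), zero_add, ← hcard,
    ← nsmul_eq_mul]
  · refine (norm_sum_le _ _).trans (Finset.sum_le_card_nsmul _ _ _ fun i _ => ?_)
    refine (norm_sub_le _ _).trans ?_
    gcongr
    refine (norm_sum_le _ _).trans
      ((Finset.sum_le_card_nsmul _ _ (R ^ m) fun a _ => ?_).trans_eq ?_)
    · refine le_trans ?_ (rowSum_pow_le hR m (a, i))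
      exact Finset.single_le_sum (f := fun y => ‖(B ^ m) (a, i) y‖)
        (fun y _ => norm_nonneg _) (Finset.mem_univ (a, i))
    · simp
  · intro i hi
    rw [hdeep i (Finset.mem_filter.1 hi).2, sub_self]

end Multilevel

/-- The fraction of the grid points near the boundary tends to zero. -/
theorem tendsto_prod_sub_div_prod {κ : Type*} {L : Filter κ} {q : ℕ} {N : κ → Fin q → ℕ}
    (hN : ∀ l, Tendsto (fun k => N k l) L atTop) (r : ℕ) :
    Tendsto (fun k => ((∏ l, (N k l : ℝ)) - ∏ l, ((N k l - r : ℕ) : ℝ)) / ∏ l, (N k l : ℝ)) L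
      (𝓝 0) := by
  have h1 : ∀ l, Tendsto (fun k => ((N k l - r : ℕ) : ℝ) / (N k l : ℝ)) L (𝓝 1) := by
    intro l
    have h : Tendsto (fun n : ℕ => ((n - r : ℕ) : ℝ) / (n : ℝ)) atTop (𝓝 1) := by
      have h2 : Tendsto (fun n : ℕ => 1 - (r : ℝ) / n) atTop (𝓝 (1 - 0)) :=
        tendsto_const_nhds.sub (tendsto_const_div_atTop_nhds_zero_nat (r : ℝ))
      rw [sub_zero] at h2
      refine h2.congr' ?_
      filter_upwards [eventually_ge_atTop (r + 1)] with n hn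
      have hn0 : (n : ℝ) ≠ 0 := by norm_cast; omega
      rw [Nat.cast_sub (by omega)]
      field_simp
    exact h.comp (hN l)
  have h2 := tendsto_finsetProd (Finset.univ : Finset (Fin q)) fun l _ => h1 l
  have h3 := (tendsto_const_nhds (x := (1 : ℝ))).sub h2
  simp only [Finset.prod_const_one, sub_self] at h3
  refine h3.congr' ?_
  have h4 : ∀ᶠ k in L, ∀ l, 1 ≤ N k l :=
    eventually_all.2 fun l => (hN l).eventually_ge_atTop 1
  filter_upwards [h4] with k hk
  have : (∏ l, (N k l : ℝ)) ≠ 0 := Finset.prod_ne_zero_iff.2 fun l _ => by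
    have := hk l
    norm_cast; omega
  rw [sub_div, div_self this, Finset.prod_div_distrib]

/-- Bounded matrices with multilevel Toeplitz interior have the trace moments of their symbol. -/
theorem tendsto_trace_pow_of_interior_toeplitz {κ : Type*} {L : Filter κ} {q s p r : ℕ}
    {ι : κ → Type*} [∀ k, Fintype (ι k)] [∀ k, DecidableEq (ι k)] {N : κ → Fin q → ℕ}
    (e : ∀ k, ι k ≃ ∀ l, Fin (N k l)) {C : (Fin q → ℤ) → Matrix (Fin s) (Fin s) ℂ}
    {B : ∀ k, Matrix (Fin s × ι k) (Fin s × ι k) ℂ}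
    (hB : ∀ k i j a b, IsDeep (e k) r i → B k (a, i) (b, j) =
      if gridPos (e k) i - gridPos (e k) j ∈ frequencyBox q p
      then C (gridPos (e k) i - gridPos (e k) j) a b else 0)
    {R : ℝ} (hR : ∀ k x, ∑ y, ‖B k x y‖ ≤ R) (hN : ∀ l, Tendsto (fun k => N k l) L atTop) (m : ℕ) :
    Tendsto (fun k => 1 / (Fintype.card (Fin s × ι k) : ℂ) * (B k ^ m).trace) L
      (𝓝 (1 / (volume.real (fourierCube q) : ℂ) *
        ∫ θ in fourierCube q, (trigPoly p C θ ^ m).trace / (s : ℂ))) := by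
  set c := ((2 * π : ℂ) ^ q)⁻¹ * ∫ θ in fourierCube q, (trigPoly p C θ ^ m).trace with hc
  have hlim : 1 / (volume.real (fourierCube q) : ℂ) *
      ∫ θ in fourierCube q, (trigPoly p C θ ^ m).trace / (s : ℂ) = c / s := by
    rw [volume_fourierCube, integral_div, hc]
    push_cast
    ring
  rw [hlim, tendsto_iff_norm_sub_tendsto_zero]
  have h0 := (tendsto_prod_sub_div_prod hN (2 * (r + m * p))).mul_const
    ((s * R ^ m + ‖c‖) * (s : ℝ)⁻¹)
  rw [zero_mul] at h0
  refine squeeze_zero' (Eventually.of_forall fun k => norm_nonneg _) ?_ h0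
  have h4 : ∀ᶠ k in L, ∀ l, 1 ≤ N k l :=
    eventually_all.2 fun l => (hN l).eventually_ge_atTop 1
  filter_upwards [h4] with k hk
  have hcard : (Fintype.card (ι k) : ℝ) = ∏ l, (N k l : ℝ) := by
    rw [Fintype.card_congr (e k), Fintype.card_pi]
    simp
  have hpos : 0 < (Fintype.card (ι k) : ℝ) := by
    rw [hcard]
    exact Finset.prod_pos fun l _ => by exact_mod_cast hk l
  have hne : (Fintype.card (ι k) : ℂ) ≠ 0 := by exact_mod_cast hpos.ne'
  have heq : 1 / (Fintype.card (Fin s × ι k) : ℂ) * (B k ^ m).trace - c / s =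
      ((B k ^ m).trace - Fintype.card (ι k) * c) * ((Fintype.card (ι k) : ℂ)⁻¹ * (s : ℂ)⁻¹) := by
    rw [Fintype.card_prod, Fintype.card_fin]
    push_cast
    rw [sub_mul, mul_mul_mul_comm (Fintype.card (ι k) : ℂ), mul_inv_cancel₀ hne]
    ring
  rw [heq, norm_mul, norm_mul, norm_inv, norm_inv, Complex.norm_natCast, Complex.norm_natCast]
  refine (mul_le_mul_of_nonneg_right (norm_trace_pow_sub_le (e k) (hB k) (hR k) m)
    (by positivity)).trans_eq ?_
  rw [← hcard, ← hc]
  ring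

/-! ### Sums of tensor products -/

section TensorSum

variable {q s p : ℕ} {T : Type*} [Fintype T]

/-- The Toeplitz coefficients of the matrix `∑ t, Γ t ⊗ X t 1 ⊗ ⋯ ⊗ X t q`, where `X t l` has the
Toeplitz coefficients `c t l`. -/
noncomputable def tensorCoeff (Γ : T → Matrix (Fin s) (Fin s) ℝ) (c : T → Fin q → ℤ → ℝ)
    (v : Fin q → ℤ) : Matrix (Fin s) (Fin s) ℂ :=
  Matrix.of fun a b => ((∑ t, Γ t a b * ∏ l, c t l (v l) : ℝ) : ℂ)

/-- The trigonometric polynomial with coefficients `c k`, `|k| ≤ p`. -/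
noncomputable def toeplitzSymbol (p : ℕ) (c : ℤ → ℝ) (θ : ℝ) : ℂ :=
  ∑ k ∈ Finset.Icc (-(p : ℤ)) p, (c k : ℂ) * Complex.exp (Complex.I * k * θ)

theorem trigPoly_tensorCoeff (Γ : T → Matrix (Fin s) (Fin s) ℝ) (c : T → Fin q → ℤ → ℝ)
    (θ : Fin q → ℝ) (a b : Fin s) :
    trigPoly p (tensorCoeff Γ c) θ a b =
      ∑ t, (Γ t a b : ℂ) * ∏ l, toeplitzSymbol p (c t l) (θ l) := by
  simp_rw [toeplitzSymbol, Finset.prod_univ_sum, Finset.mul_sum, trigPoly, Matrix.sum_apply,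
    Matrix.smul_apply, tensorCoeff, Matrix.of_apply, smul_eq_mul]
  rw [Finset.sum_comm]
  refine Finset.sum_congr rfl fun k _ => ?_
  push_cast
  rw [Finset.mul_sum]
  refine Finset.sum_congr rfl fun t _ => ?_
  rw [Finset.prod_mul_distrib, torusChar]
  ring

variable {ι : Type*} {N : Fin q → ℕ} {K : ℝ} {Γ : T → Matrix (Fin s) (Fin s) ℝ}
  {c : T → Fin q → ℤ → ℝ} {X : T → ∀ l, Matrix (Fin (N l)) (Fin (N l)) ℝ}
  {B : Matrix (Fin s × ι) (Fin s × ι) ℂ}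

theorem tensorSum_apply_eq_zero (e : ι ≃ ∀ l, Fin (N l))
    (hX : ∀ t l, IsInteriorToeplitz p K (c t l) (X t l))
    (hB : ∀ i j a b, B (a, i) (b, j) =
      ((∑ t, Γ t a b * ∏ l, X t l (e i l) (e j l) : ℝ) : ℂ)) {i j : ι} (a b : Fin s)
    (hij : gridPos e i - gridPos e j ∉ frequencyBox q p) : B (a, i) (b, j) = 0 := by
  rw [mem_frequencyBox] at hij
  push Not at hij
  obtain ⟨l, hl⟩ := hij
  rw [hB, Finset.sum_eq_zero fun t _ => ?_, Complex.ofReal_zero]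
  rw [Finset.prod_eq_zero (Finset.mem_univ l) ((hX t l).band _ _ hl), mul_zero]

/-- Depth `2 * p` in the row ensures depth `p` in both the row and every column of the band. -/
theorem tensorSum_apply_of_isDeep (e : ι ≃ ∀ l, Fin (N l))
    (hX : ∀ t l, IsInteriorToeplitz p K (c t l) (X t l))
    (hB : ∀ i j a b, B (a, i) (b, j) =
      ((∑ t, Γ t a b * ∏ l, X t l (e i l) (e j l) : ℝ) : ℂ)) (i j : ι) (a b : Fin s)
    (hi : IsDeep e (2 * p) i) : B (a, i) (b, j) =
      if gridPos e i - gridPos e j ∈ frequencyBox q p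
      then tensorCoeff Γ c (gridPos e i - gridPos e j) a b else 0 := by
  split_ifs with h
  · rw [hB, tensorCoeff, Matrix.of_apply]
    congr 1
    refine Finset.sum_congr rfl fun t _ => ?_
    congr 1
    refine Finset.prod_congr rfl fun l _ => ?_
    have h1 := mem_frequencyBox.1 h l
    have h2 := hi l
    have h3 := abs_le.1 h1
    simp only [gridPos, Pi.sub_apply] at h1 h2 h3
    push_cast at h2
    exact (hX t l).interior _ _ (by omega) (by omega) (by omega) (by omega) h1
  · exact tensorSum_apply_eq_zero e hX hB a b h

variable [Fintype ι]

/-- Each row has at most as many nonzero blocks as the frequency box has elements. The outer sum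
over `a` only serves to make the bound independent of the row. -/
theorem tensorSum_rowSum_le (e : ι ≃ ∀ l, Fin (N l))
    (hX : ∀ t l, IsInteriorToeplitz p K (c t l) (X t l))
    (hB : ∀ i j a b, B (a, i) (b, j) =
      ((∑ t, Γ t a b * ∏ l, X t l (e i l) (e j l) : ℝ) : ℂ)) (x : Fin s × ι) :
    ∑ y, ‖B x y‖ ≤ ∑ a, ∑ b, (frequencyBox q p).card * ∑ t, |Γ t a b| * K ^ q := by
  classical
  obtain ⟨a, i⟩ := x
  have hK : ∀ t l, 0 ≤ K := fun t l =>
    (abs_nonneg (X t l (e i l) (e i l))).trans ((hX t l).bound _ _)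
  have hKq : ∀ t : T, 0 ≤ K ^ q := fun t => by
    rcases q.eq_zero_or_pos with rfl | h
    · simp
    · exact pow_nonneg (hK t ⟨0, h⟩) _
  have hnn : ∀ a b, 0 ≤ ∑ t, |Γ t a b| * K ^ q := fun a b =>
    Finset.sum_nonneg fun t _ => mul_nonneg (abs_nonneg _) (hKq t)
  have hentry : ∀ b j, ‖B (a, i) (b, j)‖ ≤ ∑ t, |Γ t a b| * K ^ q := by
    intro b j
    rw [hB, Complex.norm_real, Real.norm_eq_abs]
    refine (Finset.abs_sum_le_sum_abs _ _).trans (Finset.sum_le_sum fun t _ => ?_)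
    rw [abs_mul, Finset.abs_prod]
    gcongr
    exact (Finset.prod_le_prod (fun l _ => abs_nonneg _) fun l _ => (hX t l).bound _ _).trans_eq
      (by simp)
  rw [Fintype.sum_prod_type]
  refine le_trans (Finset.sum_le_sum fun b _ => ?_) (Finset.single_le_sum
    (f := fun a => ∑ b, ((frequencyBox q p).card : ℝ) * ∑ t, |Γ t a b| * K ^ q)
    (fun a _ => Finset.sum_nonneg fun b _ => mul_nonneg (by positivity) (hnn a b))
    (Finset.mem_univ a))
  rw [← Finset.sum_subset (Finset.filter_subset
    (fun j => gridPos e i - gridPos e j ∈ frequencyBox q p) Finset.univ)]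
  · refine (Finset.sum_le_card_nsmul _ _ _ fun j _ => hentry b j).trans ?_
    rw [nsmul_eq_mul]
    refine mul_le_mul_of_nonneg_right ?_ (hnn a b)
    norm_cast
    exact Finset.card_le_card_of_injOn (fun j => gridPos e i - gridPos e j)
      (fun j hj => (Finset.mem_filter.1 hj).2)
      (fun j _ j' _ h => gridPos_injective e (sub_right_injective h))
  · intro j _ hj
    rw [tensorSum_apply_eq_zero e hX hB a b (by simpa using hj), norm_zero]

end TensorSum

/-! ### The one-dimensional symbols -/

theorem sum_Icc_neg_eq (p : ℕ) (g : ℤ → ℂ) :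
    ∑ k ∈ Finset.Icc (-(p : ℤ)) p, g k = g 0 + ∑ k ∈ Finset.Icc 1 p, (g k + g (-(k : ℤ))) := by
  induction p with
  | zero => simp
  | succ p ih =>
    have h : Finset.Icc (-((p + 1 : ℕ) : ℤ)) ((p + 1 : ℕ) : ℤ) =
        insert ((p + 1 : ℕ) : ℤ) (insert (-((p + 1 : ℕ) : ℤ)) (Finset.Icc (-(p : ℤ)) p)) := by
      ext k
      simp only [Finset.mem_insert, Finset.mem_Icc]
      push_cast
      omega
    rw [h, Finset.sum_insert (by simp; omega), Finset.sum_insert (by simp), ih,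
      Finset.sum_Icc_succ_top (by omega)]
    ring

theorem toeplitzSymbol_of_even {p : ℕ} {c : ℤ → ℝ} (hc : ∀ k, c (-k) = c k) (θ : ℝ) :
    toeplitzSymbol p c θ =
      ((c 0 + 2 * ∑ k ∈ Finset.Icc 1 p, c (k : ℤ) * Real.cos (k * θ) : ℝ) : ℂ) := by
  rw [toeplitzSymbol, sum_Icc_neg_eq]
  push_cast
  rw [Finset.mul_sum]
  congr 1
  · simp
  · refine Finset.sum_congr rfl fun k _ => ?_
    rw [hc, Complex.cos]
    ring_nf

theorem toeplitzSymbol_of_odd {p : ℕ} {c : ℤ → ℝ} (hc : ∀ k, c (-k) = -c k) (θ : ℝ) :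
    toeplitzSymbol p c θ =
      Complex.I * ((2 * ∑ k ∈ Finset.Icc 1 p, c (k : ℤ) * Real.sin (k * θ) : ℝ) : ℂ) := by
  have h0 : c 0 = 0 := by
    have := hc 0
    rw [neg_zero] at this
    linarith
  rw [toeplitzSymbol, sum_Icc_neg_eq]
  push_cast
  rw [Finset.mul_sum, Finset.mul_sum, h0]
  simp only [Complex.ofReal_zero, zero_mul, zero_add]
  refine Finset.sum_congr rfl fun k _ => ?_
  rw [hc, Complex.sin]
  push_cast
  ring_nf
  rw [Complex.I_sq]
  ring

theorem cardinalBSpline_center_symm {p : ℕ} (t : ℝ) :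
    cardinalBSpline (2 * p + 1) ((p : ℝ) + 1 + t) =
      cardinalBSpline (2 * p + 1) ((p : ℝ) + 1 - t) := by
  rw [← cardinalBSpline_symm (by omega)]
  congr 1
  push_cast
  ring

theorem deriv_cardinalBSpline_center_symm {p : ℕ} (t : ℝ) :
    deriv (cardinalBSpline (2 * p + 1)) ((p : ℝ) + 1 + t) =
      -deriv (cardinalBSpline (2 * p + 1)) ((p : ℝ) + 1 - t) := by
  have h := congrArg (fun f : ℝ → ℝ => deriv f t) (funext (cardinalBSpline_center_symm (p := p)))
  simp only [deriv_comp_const_add, deriv_comp_const_sub] at h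
  exact h

theorem iteratedDeriv_cardinalBSpline_center_symm {p : ℕ} (t : ℝ) :
    iteratedDeriv 2 (cardinalBSpline (2 * p + 1)) ((p : ℝ) + 1 + t) =
      iteratedDeriv 2 (cardinalBSpline (2 * p + 1)) ((p : ℝ) + 1 - t) := by
  rw [iteratedDeriv_succ, iteratedDeriv_one]
  have h := congrArg (fun f : ℝ → ℝ => deriv f t)
    (funext (deriv_cardinalBSpline_center_symm (p := p)))
  simp only [deriv_comp_const_add, deriv.fun_neg, deriv_comp_const_sub, neg_neg] at h
  exact h

/-- The four one-dimensional bilinear forms that occur in the tensor products. -/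
inductive SplineForm
  | mass
  | advection
  | advectionT
  | stiffness

/-- The matrices `n M`, `A`, `Aᵀ`, `n⁻¹ S`, whose entries do not grow with `n`. -/
noncomputable def SplineForm.matrix (p n : ℕ) :
    SplineForm → Matrix (Fin (n + p - 2)) (Fin (n + p - 2)) ℝ
  | mass => (n : ℝ) • massMatrix p n
  | advection => advectionMatrix p n
  | advectionT => (advectionMatrix p n).transpose
  | stiffness => (n : ℝ)⁻¹ • stiffnessMatrix p n

/-- The Toeplitz coefficients of the matrices `n M`, `A`, `Aᵀ`, `n⁻¹ S`. -/
noncomputable def SplineForm.coeff (p : ℕ) : SplineForm → ℤ → ℝ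
  | mass => fun k => cardinalBSpline (2 * p + 1) ((p : ℝ) + 1 - k)
  | advection => fun k => -deriv (cardinalBSpline (2 * p + 1)) ((p : ℝ) + 1 - k)
  | advectionT => fun k => -deriv (cardinalBSpline (2 * p + 1)) ((p : ℝ) + 1 - (-k : ℤ))
  | stiffness => fun k => -iteratedDeriv 2 (cardinalBSpline (2 * p + 1)) ((p : ℝ) + 1 - k)

/-- The symbols of the matrices `n M`, `A`, `Aᵀ`, `n⁻¹ S`. -/
noncomputable def SplineForm.symbol (p : ℕ) : SplineForm → ℝ → ℂ
  | mass => fun θ => massSymbol p θ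
  | advection => fun θ => Complex.I * advectionSymbol p θ
  | advectionT => fun θ => -(Complex.I * advectionSymbol p θ)
  | stiffness => fun θ => stiffnessSymbol p θ

theorem SplineForm.isInteriorToeplitz {p n : ℕ} (hp : 1 ≤ p) (hn : 0 < n) (w : SplineForm) :
    IsInteriorToeplitz p (entryBound p) (w.coeff p) (w.matrix p n) := by
  cases w
  · exact isInteriorToeplitz_mass hp hn
  · exact isInteriorToeplitz_advection hp hn
  · exact (isInteriorToeplitz_advection hp hn).transpose
  · exact isInteriorToeplitz_stiffness hp hn

theorem SplineForm.toeplitzSymbol_coeff (p : ℕ) (w : SplineForm) (θ : ℝ) :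
    toeplitzSymbol p (w.coeff p) θ = w.symbol p θ := by
  have hodd : ∀ k : ℤ, -deriv (cardinalBSpline (2 * p + 1)) ((p : ℝ) + 1 - (-k : ℤ)) =
      - -deriv (cardinalBSpline (2 * p + 1)) ((p : ℝ) + 1 - k) := by
    intro k
    rw [← deriv_cardinalBSpline_center_symm]
    push_cast
    ring_nf
  cases w
  · rw [toeplitzSymbol_of_even fun k => ?_]
    · simp [coeff, symbol, massSymbol]
    · simp only [coeff]
      rw [← cardinalBSpline_center_symm]
      push_cast
      ring_nf
  · rw [toeplitzSymbol_of_odd fun k => hodd k]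
    simp [coeff, symbol, advectionSymbol]
  · rw [toeplitzSymbol_of_odd fun k => ?_]
    · simp only [coeff, symbol, advectionSymbol, hodd]
      simp
    · simp only [coeff, hodd, neg_neg]
  · rw [toeplitzSymbol_of_even fun k => ?_]
    · simp [coeff, symbol, stiffnessSymbol, sub_eq_add_neg]
    · simp only [coeff]
      rw [← iteratedDeriv_cardinalBSpline_center_symm]
      push_cast
      ring_nf

/-! ### The curl-div matrix as a sum of tensor products -/

/-- The grid behind the tensor-product B-splines. -/
def splineIndexEquiv (p : ℕ) (n : Fin 3 → ℕ) :
    SplineIndex p (n 0) (n 1) (n 2) ≃ ∀ l, Fin (n l + p - 2) where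
  toFun i l := match l with
    | 0 => i.1
    | 1 => i.2.1
    | 2 => i.2.2
  invFun v := (v 0, v 1, v 2)
  left_inv _ := rfl
  right_inv v := by
    funext l
    fin_cases l <;> rfl

/-- The tensor products that occur in the blocks of the curl-div matrix: `.inl l` has the stiffness
matrix in direction `l` and mass matrices in the others, `.inr (l, _)` has the mass matrix in
direction `l` and `A`, `Aᵀ` or `Aᵀ`, `A` in the other two. -/
def curlDivForm : Fin 3 ⊕ Fin 3 × Bool → Fin 3 → SplineForm
  | .inl 0 => ![.stiffness, .mass, .mass]
  | .inl 1 => ![.mass, .stiffness, .mass]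
  | .inl 2 => ![.mass, .mass, .stiffness]
  | .inr (0, false) => ![.mass, .advection, .advectionT]
  | .inr (0, true) => ![.mass, .advectionT, .advection]
  | .inr (1, false) => ![.advection, .mass, .advectionT]
  | .inr (1, true) => ![.advectionT, .mass, .advection]
  | .inr (2, false) => ![.advection, .advectionT, .mass]
  | .inr (2, true) => ![.advectionT, .advection, .mass]

/-- The coefficients of the tensor products `curlDivForm` in the `3 × 3` blocks of `n 𝒜`, for the
scale-invariant matrices `SplineForm.matrix`. -/
noncomputable def curlDivWeight (α β : ℝ) (ν : Fin 3 → ℚ) :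
    Fin 3 ⊕ Fin 3 × Bool → Matrix (Fin 3) (Fin 3) ℝ
  | .inl l => symbolGamma ν l • Matrix.diagonal fun a => if a = l then β else α
  | .inr (0, false) => symbolDelta ν 0 • !![0, 0, 0; 0, 0, β; 0, -α, 0]
  | .inr (0, true) => symbolDelta ν 0 • !![0, 0, 0; 0, 0, -α; 0, β, 0]
  | .inr (1, false) => symbolDelta ν 1 • !![0, 0, β; 0, 0, 0; -α, 0, 0]
  | .inr (1, true) => symbolDelta ν 1 • !![0, 0, -α; 0, 0, 0; β, 0, 0]
  | .inr (2, false) => symbolDelta ν 2 • !![0, β, 0; -α, 0, 0; 0, 0, 0]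
  | .inr (2, true) => symbolDelta ν 2 • !![0, -α, 0; β, 0, 0; 0, 0, 0]

/-- The sum over the nine tensor products, written out block by block. It is used over `ℝ` for the
entries of the matrix and over `ℂ` for the symbol. -/
theorem sum_curlDivWeight {R : Type*} [CommRing R] (φ : ℝ →+* R) (α β : ℝ) (ν : Fin 3 → ℚ)
    (x : SplineForm → Fin 3 → R) (a b : Fin 3) :
    ∑ t, φ (curlDivWeight α β ν t a b) * ∏ l, x (curlDivForm t l) l =
      let m := x .mass
      let d := x .advection
      let d' := x .advectionT
      let s := x .stiffness
      let γ := fun l => φ (symbolGamma ν l)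
      let δ := fun l => φ (symbolDelta ν l)
      !![φ β * γ 0 * (s 0 * m 1 * m 2) + φ α * γ 1 * (m 0 * s 1 * m 2)
            + φ α * γ 2 * (m 0 * m 1 * s 2),
          δ 2 * (φ β * (d 0 * d' 1) - φ α * (d' 0 * d 1)) * m 2,
          δ 1 * (φ β * (d 0 * d' 2) - φ α * (d' 0 * d 2)) * m 1;
        δ 2 * (φ β * (d' 0 * d 1) - φ α * (d 0 * d' 1)) * m 2,
          φ α * γ 0 * (s 0 * m 1 * m 2) + φ β * γ 1 * (m 0 * s 1 * m 2)
            + φ α * γ 2 * (m 0 * m 1 * s 2),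
          δ 0 * (φ β * (d 1 * d' 2) - φ α * (d' 1 * d 2)) * m 0;
        δ 1 * (φ β * (d' 0 * d 2) - φ α * (d 0 * d' 2)) * m 1,
          δ 0 * (φ β * (d' 1 * d 2) - φ α * (d 1 * d' 2)) * m 0,
          φ α * γ 0 * (s 0 * m 1 * m 2) + φ α * γ 1 * (m 0 * s 1 * m 2)
            + φ β * γ 2 * (m 0 * m 1 * s 2)] a b := by
  rw [Fintype.sum_sum_type, Fintype.sum_prod_type]
  simp only [Fin.sum_univ_three, Fintype.sum_bool, Fin.prod_univ_three, curlDivForm, curlDivWeight]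
  fin_cases a <;> fin_cases b <;>
    simp <;> ring

theorem curlDivMatrix_apply (p : ℕ) (α β : ℝ) (n₁ n₂ n₃ : ℕ) (i j : SplineIndex p n₁ n₂ n₃)
    (a b : Fin 3) : curlDivMatrix p α β n₁ n₂ n₃ (a, i) (b, j) =
      let m₁ := massMatrix p n₁ i.1 j.1
      let m₂ := massMatrix p n₂ i.2.1 j.2.1
      let m₃ := massMatrix p n₃ i.2.2 j.2.2
      let d₁ := advectionMatrix p n₁ i.1 j.1
      let d₂ := advectionMatrix p n₂ i.2.1 j.2.1
      let d₃ := advectionMatrix p n₃ i.2.2 j.2.2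
      let d₁' := advectionMatrix p n₁ j.1 i.1
      let d₂' := advectionMatrix p n₂ j.2.1 i.2.1
      let d₃' := advectionMatrix p n₃ j.2.2 i.2.2
      let s₁ := stiffnessMatrix p n₁ i.1 j.1
      let s₂ := stiffnessMatrix p n₂ i.2.1 j.2.1
      let s₃ := stiffnessMatrix p n₃ i.2.2 j.2.2
      !![α * (m₁ * (m₂ * s₃) + m₁ * (s₂ * m₃)) + β * (s₁ * (m₂ * m₃)),
          α * -(d₁' * (d₂ * m₃)) + β * (d₁ * (d₂' * m₃)),
          α * -(d₁' * (m₂ * d₃)) + β * (d₁ * (m₂ * d₃'));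
        α * -(d₁ * (d₂' * m₃)) + β * (d₁' * (d₂ * m₃)),
          α * (s₁ * (m₂ * m₃) + m₁ * (m₂ * s₃)) + β * (m₁ * (s₂ * m₃)),
          α * -(m₁ * (d₂' * d₃)) + β * (m₁ * (d₂ * d₃'));
        α * -(d₁ * (m₂ * d₃')) + β * (d₁' * (m₂ * d₃)),
          α * -(m₁ * (d₂ * d₃')) + β * (m₁ * (d₂' * d₃)),
          α * (s₁ * (m₂ * m₃) + m₁ * (s₂ * m₃)) + β * (m₁ * (m₂ * s₃))] a b := by
  fin_cases a <;> fin_cases b <;> rfl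

/-- With `N l = n * ν l`, rescaling the one-dimensional matrices to be independent of `n` turns the
factor `n` into `γ` and `δ`. -/
theorem smul_curlDivMatrix_apply {p : ℕ} {α β : ℝ} {ν : Fin 3 → ℚ} (hν : ∀ i, 0 < ν i) {n : ℕ}
    (hn : 0 < n) {N : Fin 3 → ℕ} (hN : ∀ l, (N l : ℝ) = n * ν l)
    (i j : SplineIndex p (N 0) (N 1) (N 2)) (a b : Fin 3) :
    ((n : ℝ) • curlDivMatrix p α β (N 0) (N 1) (N 2)) (a, i) (b, j) =
      ∑ t, curlDivWeight α β ν t a b * ∏ l, (curlDivForm t l).matrix p (N l)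
        (splineIndexEquiv p N i l) (splineIndexEquiv p N j l) := by
  have h := sum_curlDivWeight (RingHom.id ℝ) α β ν (fun w l => w.matrix p (N l)
    (splineIndexEquiv p N i l) (splineIndexEquiv p N j l)) a b
  simp only [RingHom.id_apply] at h
  rw [h]
  rw [Matrix.smul_apply, curlDivMatrix_apply, smul_eq_mul]
  have hn' : (n : ℝ) ≠ 0 := by positivity
  have hν' : ∀ l, (ν l : ℝ) ≠ 0 := fun l => by exact_mod_cast (hν l).ne'
  have h0 := hν' 0
  have h1 := hν' 1
  have h2 := hν' 2
  clear h
  fin_cases a <;> fin_cases b <;>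
    simp [SplineForm.matrix, splineIndexEquiv, symbolGamma, symbolDelta, hN] <;>
    field_simp <;> ring

/-- As `A` and `Aᵀ` have the symbols `i 𝔞` and `-i 𝔞`, both `A ⊗ Aᵀ` and `Aᵀ ⊗ A` have the symbol
`𝔞 𝔞`, which produces the factor `-(α - β)`. -/
theorem curlDivSymbol_eq_trigPoly (p : ℕ) (α β : ℝ) (ν : Fin 3 → ℚ) :
    curlDivSymbol p α β ν = trigPoly p
      (tensorCoeff (curlDivWeight α β ν) fun t l => (curlDivForm t l).coeff p) := by
  funext θ
  ext a b
  rw [trigPoly_tensorCoeff]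
  simp_rw [SplineForm.toeplitzSymbol_coeff]
  have h := sum_curlDivWeight Complex.ofRealHom α β ν (fun w l => w.symbol p (θ l)) a b
  simp only [Complex.ofRealHom_eq_coe] at h
  rw [h]
  clear h
  fin_cases a <;> fin_cases b <;>
    simp [curlDivSymbol, SplineForm.symbol, -mul_eq_mul_right_iff] <;>
    ring_nf <;> simp only [Complex.I_sq] <;> ring

theorem isHermitian_curlDivSymbol (p : ℕ) (α β : ℝ) (ν : Fin 3 → ℚ) (θ : Fin 3 → ℝ) :
    (curlDivSymbol p α β ν θ).IsHermitian := by
  ext a b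
  fin_cases a <;> fin_cases b <;> simp [curlDivSymbol]

theorem massMatrix_apply_comm (p n : ℕ) (i j : Fin (n + p - 2)) :
    massMatrix p n i j = massMatrix p n j i := by
  simp only [massMatrix, Matrix.of_apply, mul_comm]

theorem stiffnessMatrix_apply_comm (p n : ℕ) (i j : Fin (n + p - 2)) :
    stiffnessMatrix p n i j = stiffnessMatrix p n j i := by
  simp only [stiffnessMatrix, Matrix.of_apply, mul_comm]

theorem curlDivMatrix_apply_comm (p : ℕ) (α β : ℝ) (n₁ n₂ n₃ : ℕ)
    (x y : Fin 3 × SplineIndex p n₁ n₂ n₃) :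
    curlDivMatrix p α β n₁ n₂ n₃ x y = curlDivMatrix p α β n₁ n₂ n₃ y x := by
  obtain ⟨a, i⟩ := x
  obtain ⟨b, j⟩ := y
  rw [curlDivMatrix_apply, curlDivMatrix_apply, massMatrix_apply_comm _ _ i.1,
    massMatrix_apply_comm _ _ i.2.1, massMatrix_apply_comm _ _ i.2.2,
    stiffnessMatrix_apply_comm _ _ i.1, stiffnessMatrix_apply_comm _ _ i.2.1,
    stiffnessMatrix_apply_comm _ _ i.2.2]
  fin_cases a <;> fin_cases b <;> simp

/-! ### The scales -/

theorem cast_scaledIndex {ν : Fin 3 → ℚ} (n : AdmissibleScale ν) (i : Fin 3) :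
    ((scaledIndex ν n i : ℕ) : ℝ) = ((n : ℕ) : ℝ) * ν i := by
  obtain ⟨k, hk⟩ := n.2.2 i
  have h : ((scaledIndex ν n i : ℕ) : ℚ) = ((n : ℕ) : ℚ) * ν i := by
    rw [scaledIndex, hk, Nat.floor_natCast]
  exact_mod_cast h

/-- The common multiples of the denominators are admissible, so admissible scales are unbounded. -/
theorem exists_admissibleScale_ge {ν : Fin 3 → ℚ} (hν : ∀ i, 0 < ν i) (m : ℕ) :
    ∃ n : AdmissibleScale ν, m ≤ (n : ℕ) := by
  set D := ∏ i, (ν i).den with hD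
  have hDpos : 0 < D := Finset.prod_pos fun i _ => (ν i).den_pos
  refine ⟨⟨(m + 1) * D, by positivity, fun i => ?_⟩, ?_⟩
  · obtain ⟨d, hd⟩ : (ν i).den ∣ D := Finset.dvd_prod_of_mem _ (Finset.mem_univ i)
    refine ⟨(m + 1) * d * (ν i).num.toNat, ?_⟩
    have h1 : (((ν i).num.toNat : ℕ) : ℚ) = (ν i).num := by
      exact_mod_cast Int.toNat_of_nonneg (Rat.num_nonneg.2 (hν i).le)
    have h2 := Rat.mul_den_eq_num (ν i)
    rw [hd]
    push_cast
    rw [h1, ← h2]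
    ring
  · show m ≤ (m + 1) * D
    nlinarith

theorem tendsto_scaledIndex {ν : Fin 3 → ℚ} (hν : ∀ i, 0 < ν i) (i : Fin 3) :
    Tendsto (fun n : AdmissibleScale ν => scaledIndex ν n i) atTop atTop := by
  have h1 : Tendsto (fun n : AdmissibleScale ν => (n : ℕ)) atTop atTop :=
    Monotone.tendsto_atTop_atTop (fun _ _ h => h) fun m => exists_admissibleScale_ge hν m
  rw [← tendsto_natCast_atTop_iff (R := ℝ)]
  simp_rw [cast_scaledIndex]
  have h2 : (0 : ℝ) < ν i := by exact_mod_cast hν i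
  exact (tendsto_natCast_atTop_atTop.comp h1).atTop_mul_const h2

theorem scaledIndex_pos {ν : Fin 3 → ℚ} (hν : ∀ i, 0 < ν i) (n : AdmissibleScale ν) (i : Fin 3) :
    0 < scaledIndex ν n i := by
  have h : (0 : ℝ) < ((n : ℕ) : ℝ) * ν i :=
    mul_pos (by exact_mod_cast n.2.1) (by exact_mod_cast hν i)
  rw [← cast_scaledIndex] at h
  exact_mod_cast h

theorem mainTheorem2 (p : ℕ) (hp : 1 ≤ p) (α β : ℝ) (ν : Fin 3 → ℚ) (hν : ∀ i, 0 < ν i) :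
    (∀ θ ∈ Set.Icc (fun _ : Fin 3 => -π) (fun _ => π), (curlDivSymbol p α β ν θ).IsHermitian) ∧
    EigenvalueDistributed (atTop : Filter (AdmissibleScale ν))
      (fun n : AdmissibleScale ν =>
        (((n : ℕ) : ℝ) • curlDivMatrix p α β
          (scaledIndex ν n 0) (scaledIndex ν n 1) (scaledIndex ν n 2)).map (fun x : ℝ => (x : ℂ)))
      (curlDivSymbol p α β ν)
      (Set.Icc (fun _ : Fin 3 => -π) (fun _ => π)) := by
  refine ⟨fun θ _ => isHermitian_curlDivSymbol p α β ν θ, ?_⟩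
  have hB := fun (n : AdmissibleScale ν) (i j : SplineIndex p (scaledIndex ν n 0)
      (scaledIndex ν n 1) (scaledIndex ν n 2)) (a b : Fin 3) =>
    congrArg (fun x : ℝ => (x : ℂ)) (smul_curlDivMatrix_apply (p := p) (α := α) (β := β) hν n.2.1
      (N := scaledIndex ν n) (fun l => cast_scaledIndex n l) i j a b)
  have hX := fun (n : AdmissibleScale ν) t (l : Fin 3) =>
    (curlDivForm t l).isInteriorToeplitz hp (scaledIndex_pos hν n l)
  have hR := fun n : AdmissibleScale ν => tensorSum_rowSum_le
    (B := (((n : ℕ) : ℝ) • curlDivMatrix p α β (scaledIndex ν n 0) (scaledIndex ν n 1)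
      (scaledIndex ν n 2)).map (fun x : ℝ => (x : ℂ)))
    (splineIndexEquiv p (scaledIndex ν n)) (hX n) (hB n)
  have hN : ∀ l, Tendsto (fun n : AdmissibleScale ν => scaledIndex ν n l + p - 2) atTop atTop := by
    intro l
    refine tendsto_atTop_mono (fun n => ?_)
      ((tendsto_sub_atTop_nat 2).comp (tendsto_scaledIndex hν l))
    simp only [Function.comp_apply]
    omega
  have hvol : volume.real (fourierCube 3) = (2 * π) ^ 3 := volume_fourierCube 3
  refine eigenvalueDistributed_of_tendsto_trace_pow isCompact_Icc ?_ ?_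
    (fun θ _ => isHermitian_curlDivSymbol p α β ν θ) (fun n => ?_) hR ?_ fun m => ?_
  · rw [pos_iff_ne_zero]
    intro h
    have h' : volume.real (fourierCube 3) = 0 := by rw [Measure.real, fourierCube, h]; rfl
    rw [h'] at hvol
    have : (0 : ℝ) < (2 * π) ^ 3 := by positivity
    linarith
  · rw [curlDivSymbol_eq_trigPoly]
    exact continuous_trigPoly _ _
  · ext x y
    simp [curlDivMatrix_apply_comm p α β _ _ _ y x]
  · refine tendsto_atTop_mono (fun n => ?_)
      ((hN 0).atTop_mul_atTop₀ ((hN 1).atTop_mul_atTop₀ (hN 2)))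
    simp only [Fintype.card_prod, Fintype.card_fin]
    omega
  · rw [curlDivSymbol_eq_trigPoly]
    exact tendsto_trace_pow_of_interior_toeplitz (fun n => splineIndexEquiv p (scaledIndex ν n))
      (fun n i j a b hi => tensorSum_apply_of_isDeep _ (hX n) (hB n) i j a b hi) hR hN m
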